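/- Let $\mathbb K$ be a field and let $\Gamma$ be a simply-laced graph (no loops, no multiple edges) with vertex set $I$. For $i,j\in I$ put $i\cdot i=2$, $i\cdot j=-1$ if $i\neq j$ are joined by an edge, and $i\cdot j=0$ otherwise. A linear $(2,2)$-category is a strict $2$-category whose sets of parallel $2$-cells are $\mathbb K$-vector spaces and whose compositions $\star_0$ (horizontal) and $\star_1$ (vertical) of $2$-cells are bilinear. Consider one $0$-cell, the elements of $I$ as generating $1$-cells (so $1$-cells are words in $I$), and as generating $2$-cells the crossings $\tau_{i,j}\colon ij\to ji$ and the dots $x_i\colon i\to i$, for $i,j\in I$. A monomial is a $2$-cell of the free $2$-category on these generators. The $2$-cells of the free linear $(2,2)$-category are the finite linear combinations of parallel monomials. Compositions $\star_1$ are read from left (bottom) to right (top), and a word also denotes its identity $2$-cell. Let $\mathcal C^{\mathrm{KLR}}$ be the linear $(2,2)$-category with these generators, subject to the relations (for all $i,j,k\in I$): (1) $\tau_{i,j}\star_1\tau_{j,i}=0$ if $i=j$; it equals the identity of $ij$ if $i\cdot j=0$; and it equals $x_i\star_0 j+i\star_0 x_j$ if $i\cdot j=-1$. (2) $\tau_{i,j}\star_1(x_j\star_0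 i)=(i\star_0 x_j)\star_1\tau_{i,j}+\delta_{i,j}\,1_{ij}$ and $\tau_{i,j}\star_1(j\star_0 x_i)=(x_i\star_0 j)\star_1\tau_{i,j}-\delta_{i,j}\,1_{ij}$. (3) $(\tau_{i,j}\star_0 k)\star_1(j\star_0\tau_{i,k})\star_1(\tau_{j,k}\star_0 i)=(i\star_0\tau_{j,k})\star_1(\tau_{i,k}\star_0 j)\star_1(k\star_0\tau_{i,j})$ unless $i=k$ and $i\cdot j=-1$; if $i=k$ and $i\cdot j=-1$, the left side minus the right side is the identity of $iji$. Let $\mathrm{KLR}$ be the linear $(3,2)$-polygraph with the same $0$-cell, generating $1$-cells and generating $2$-cells, whose generating $3$-cells are these relations oriented from left to right, where the last relation in (3) is oriented as $(\text{left side})\to(\text{right side})+1_{iji}$. A rewriting step is $c\,C[s(\alpha)]+h\to c\,C[t(\alpha)]+h$, where $\alpha$ is a generating $3$-cell with source $s(\alpha)$ and target $t(\alpha)$, $c\in\mathbb K\setminus\{0\}$, $C=m_1\star_1(m_2\star_0\square\star_0 m_3)\star_1 m_4$ with monomials $m_1,\dots,m_4$, and $h$ is a $2$-cell in which the monomial $C[s(\alpha)]$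 does not occur. Two parallel $2$-cells of the free linear $(2,2)$-category are congruent if there is a $3$-cell between them in the free linear $(3,2)$-category generated by $\mathrm{KLR}$. Theorem. The linear $(3,2)$-polygraph $\mathrm{KLR}$ is a convergent presentation of $\mathcal C^{\mathrm{KLR}}$. That is: (a) (termination) there is no infinite sequence of rewriting steps; (b) (confluence) if a $2$-cell $u$ rewrites, by finite sequences of rewriting steps, to $v$ and to $w$, then $v$ and $w$ rewrite, by finite sequences of rewriting steps, to a common $2$-cell; (c) (presentation) the quotient of the free linear $(2,2)$-category by the congruence above is isomorphic to $\mathcal C^{\mathrm{KLR}}$ as a linear $(2,2)$-category. -/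

import Mathlib

open CategoryTheory

universe u v w x

/-! ## Linear (2,2)-categories -/

/-- A linear (2,2)-category over `K`: a strict 2-category whose sets of 2-cells between parallel
1-cells are `K`-vector spaces and whose two compositions of 2-cells are bilinear, i.e. a category
enriched in `K`-linear categories.  The 0-cells and 1-cells form the category `Cell0`, the
composition `⋆₀` of 1-cells being `≫`.  `vcomp` is `⋆₁` and `hcomp` is `⋆₀` on 2-cells.
The associativity and unit laws of `⋆₀` hold strictly; they are written with `HEq` since the
two sides have (propositionally) equal sources and targets. -/
structure LinearTwoCat (K : Type x) [Field K] where
  Cell0 : Type u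
  [category : Category.{v} Cell0]
  Cell2 : ∀ {a b : Cell0}, (a ⟶ b) → (a ⟶ b) → Type w
  [addCommGroup : ∀ {a b : Cell0} (p q : a ⟶ b), AddCommGroup (Cell2 p q)]
  [module : ∀ {a b : Cell0} (p q : a ⟶ b), Module K (Cell2 p q)]
  id2 : ∀ {a b : Cell0} (p : a ⟶ b), Cell2 p p
  vcomp : ∀ {a b : Cell0} {p q r : a ⟶ b}, Cell2 p q → Cell2 q r → Cell2 p r
  hcomp : ∀ {a b c : Cell0} {p q : a ⟶ b} {p' q' : b ⟶ c},
    Cell2 p q → Cell2 p' q' → Cell2 (p ≫ p') (q ≫ q')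
  id2_vcomp : ∀ {a b : Cell0} {p q : a ⟶ b} (f : Cell2 p q), vcomp (id2 p) f = f
  vcomp_id2 : ∀ {a b : Cell0} {p q : a ⟶ b} (f : Cell2 p q), vcomp f (id2 q) = f
  vcomp_assoc : ∀ {a b : Cell0} {p q r s : a ⟶ b} (f : Cell2 p q) (g : Cell2 q r)
    (h : Cell2 r s), vcomp (vcomp f g) h = vcomp f (vcomp g h)
  hcomp_id2 : ∀ {a b c : Cell0} (p : a ⟶ b) (q : b ⟶ c),
    hcomp (id2 p) (id2 q) = id2 (p ≫ q)
  /-- the exchange relation -/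
  exchange : ∀ {a b c : Cell0} {p q r : a ⟶ b} {p' q' r' : b ⟶ c} (f : Cell2 p q)
    (g : Cell2 q r) (f' : Cell2 p' q') (g' : Cell2 q' r'),
    hcomp (vcomp f g) (vcomp f' g') = vcomp (hcomp f f') (hcomp g g')
  id_hcomp : ∀ {a b : Cell0} {p q : a ⟶ b} (f : Cell2 p q), HEq (hcomp (id2 (𝟙 a)) f) f
  hcomp_id : ∀ {a b : Cell0} {p q : a ⟶ b} (f : Cell2 p q), HEq (hcomp f (id2 (𝟙 b))) f
  hcomp_assoc : ∀ {a b c d : Cell0} {p q : a ⟶ b} {p' q' : b ⟶ c} {p'' q'' : c ⟶ d}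
    (f : Cell2 p q) (g : Cell2 p' q') (h : Cell2 p'' q''),
    HEq (hcomp (hcomp f g) h) (hcomp f (hcomp g h))
  add_vcomp : ∀ {a b : Cell0} {p q r : a ⟶ b} (f f' : Cell2 p q) (g : Cell2 q r),
    vcomp (f + f') g = vcomp f g + vcomp f' g
  vcomp_add : ∀ {a b : Cell0} {p q r : a ⟶ b} (f : Cell2 p q) (g g' : Cell2 q r),
    vcomp f (g + g') = vcomp f g + vcomp f g'
  smul_vcomp : ∀ {a b : Cell0} {p q r : a ⟶ b} (c : K) (f : Cell2 p q) (g : Cell2 q r),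
    vcomp (c • f) g = c • vcomp f g
  vcomp_smul : ∀ {a b : Cell0} {p q r : a ⟶ b} (c : K) (f : Cell2 p q) (g : Cell2 q r),
    vcomp f (c • g) = c • vcomp f g
  add_hcomp : ∀ {a b c : Cell0} {p q : a ⟶ b} {p' q' : b ⟶ c} (f f' : Cell2 p q)
    (g : Cell2 p' q'), hcomp (f + f') g = hcomp f g + hcomp f' g
  hcomp_add : ∀ {a b c : Cell0} {p q : a ⟶ b} {p' q' : b ⟶ c} (f : Cell2 p q)
    (g g' : Cell2 p' q'), hcomp f (g + g') = hcomp f g + hcomp f g'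
  smul_hcomp : ∀ {a b c : Cell0} {p q : a ⟶ b} {p' q' : b ⟶ c} (k : K) (f : Cell2 p q)
    (g : Cell2 p' q'), hcomp (k • f) g = k • hcomp f g
  hcomp_smul : ∀ {a b c : Cell0} {p q : a ⟶ b} {p' q' : b ⟶ c} (k : K) (f : Cell2 p q)
    (g : Cell2 p' q'), hcomp f (k • g) = k • hcomp f g

namespace LinearTwoCat

attribute [instance] LinearTwoCat.category LinearTwoCat.addCommGroup LinearTwoCat.module

variable {K : Type x} [Field K]

/-- An isomorphism of linear (2,2)-categories: a strict 2-functor that is bijective on 0-cells and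
on 1-cells, and a linear bijection on each space of 2-cells. -/
structure Iso (C D : LinearTwoCat K) where
  functor : C.Cell0 ⥤ D.Cell0
  obj_bijective : Function.Bijective functor.obj
  map_bijective : ∀ a b : C.Cell0,
    Function.Bijective (fun p : a ⟶ b => functor.map p)
  map2 : ∀ {a b : C.Cell0} (p q : a ⟶ b),
    C.Cell2 p q ≃ₗ[K] D.Cell2 (functor.map p) (functor.map q)
  map2_id2 : ∀ {a b : C.Cell0} (p : a ⟶ b), map2 p p (C.id2 p) = D.id2 (functor.map p)
  map2_vcomp : ∀ {a b : C.Cell0} {p q r : a ⟶ b} (f : C.Cell2 p q) (g : C.Cell2 q r),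
    map2 p r (C.vcomp f g) = D.vcomp (map2 p q f) (map2 q r g)
  map2_hcomp : ∀ {a b c : C.Cell0} {p q : a ⟶ b} {p' q' : b ⟶ c} (f : C.Cell2 p q)
    (g : C.Cell2 p' q'),
    HEq (map2 (p ≫ p') (q ≫ q') (C.hcomp f g)) (D.hcomp (map2 p q f) (map2 p' q' g))

/-- A congruence on the 2-cells of a linear (2,2)-category: an equivalence relation on parallel
2-cells that is compatible with linear combinations and with both compositions. -/
structure Congruence (C : LinearTwoCat K) where
  rel : ∀ {a b : C.Cell0} {p q : a ⟶ b}, C.Cell2 p q → C.Cell2 p q → Prop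
  refl : ∀ {a b : C.Cell0} {p q : a ⟶ b} (f : C.Cell2 p q), rel f f
  symm : ∀ {a b : C.Cell0} {p q : a ⟶ b} {f g : C.Cell2 p q}, rel f g → rel g f
  trans : ∀ {a b : C.Cell0} {p q : a ⟶ b} {f g h : C.Cell2 p q},
    rel f g → rel g h → rel f h
  add : ∀ {a b : C.Cell0} {p q : a ⟶ b} {f f' g g' : C.Cell2 p q},
    rel f f' → rel g g' → rel (f + g) (f' + g')
  smul : ∀ {a b : C.Cell0} {p q : a ⟶ b} (c : K) {f f' : C.Cell2 p q},
    rel f f' → rel (c • f) (c • f')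
  vcomp : ∀ {a b : C.Cell0} {p q r : a ⟶ b} {f f' : C.Cell2 p q} {g g' : C.Cell2 q r},
    rel f f' → rel g g' → rel (C.vcomp f g) (C.vcomp f' g')
  hcomp : ∀ {a b c : C.Cell0} {p q : a ⟶ b} {p' q' : b ⟶ c} {f f' : C.Cell2 p q}
    {g g' : C.Cell2 p' q'}, rel f f' → rel g g' → rel (C.hcomp f g) (C.hcomp f' g')

namespace Congruence

variable {C : LinearTwoCat K}

/-- The smallest congruence containing a relation `R` on parallel 2-cells. -/
def generate (R : ∀ {a b : C.Cell0} {p q : a ⟶ b}, C.Cell2 p q → C.Cell2 p q → Prop) :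
    C.Congruence where
  rel f g := ∀ E : C.Congruence,
    (∀ {a b : C.Cell0} {p q : a ⟶ b} (f g : C.Cell2 p q), R f g → E.rel f g) → E.rel f g
  refl f E _ := E.refl f
  symm h E hE := E.symm (h E hE)
  trans h h' E hE := E.trans (h E hE) (h' E hE)
  add h h' E hE := E.add (h E hE) (h' E hE)
  smul c _ _ h E hE := E.smul c (h E hE)
  vcomp h h' E hE := E.vcomp (h E hE) (h' E hE)
  hcomp h h' E hE := E.hcomp (h E hE) (h' E hE)

/-- The subspace of the 2-cells that are congruent to `0`. -/
def null (E : C.Congruence) {a b : C.Cell0} (p q : a ⟶ b) : Submodule K (C.Cell2 p q) where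
  carrier := {f | E.rel f 0}
  zero_mem' := E.refl 0
  add_mem' {f g} hf hg := by
    have h := E.add hf hg
    rw [add_zero] at h
    exact h
  smul_mem' c f hf := by
    have h := E.smul c hf
    rw [smul_zero] at h
    exact h

theorem sub_mem_null_iff (E : C.Congruence) {a b : C.Cell0} {p q : a ⟶ b} (f g : C.Cell2 p q) :
    f - g ∈ E.null p q ↔ E.rel f g := by
  constructor
  · intro h
    have h1 := E.add (show E.rel (f - g) 0 from h) (E.refl g)
    rwa [sub_add_cancel, zero_add] at h1
  · intro h
    have h1 := E.add h (E.refl (-g))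
    rw [add_neg_cancel, ← sub_eq_add_neg] at h1
    exact h1

/-- The space of classes of 2-cells modulo the congruence. -/
abbrev QuotCell (E : C.Congruence) {a b : C.Cell0} (p q : a ⟶ b) : Type _ :=
  C.Cell2 p q ⧸ E.null p q

/-- The class of a 2-cell. -/
abbrev cls (E : C.Congruence) {a b : C.Cell0} {p q : a ⟶ b} (f : C.Cell2 p q) : E.QuotCell p q :=
  Submodule.Quotient.mk f

/-- The quotient identifies exactly the congruent 2-cells. -/
theorem cls_eq_cls_iff (E : C.Congruence) {a b : C.Cell0} {p q : a ⟶ b} (f g : C.Cell2 p q) :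
    E.cls f = E.cls g ↔ E.rel f g :=
  (Submodule.Quotient.eq _).trans (E.sub_mem_null_iff f g)

theorem cls_surjective (E : C.Congruence) {a b : C.Cell0} {p q : a ⟶ b} (f : E.QuotCell p q) :
    ∃ g : C.Cell2 p q, E.cls g = f :=
  Submodule.Quotient.mk_surjective _ f

theorem cls_heq (E : C.Congruence) {a b : C.Cell0} {p q p' q' : a ⟶ b} (hp : p = p')
    (hq : q = q') {f : C.Cell2 p q} {g : C.Cell2 p' q'} (h : HEq f g) :
    HEq (E.cls f) (E.cls g) := by
  subst hp hq
  rw [eq_of_heq h]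

/-- The `⋆₁`-composition of classes. -/
def qvcomp (E : C.Congruence) {a b : C.Cell0} {p q r : a ⟶ b} (f : E.QuotCell p q)
    (g : E.QuotCell q r) : E.QuotCell p r :=
  Quotient.liftOn₂ f g (fun f g => E.cls (C.vcomp f g)) (by
    intro f g f' g' hf hg
    refine (E.cls_eq_cls_iff _ _).2 (E.vcomp ?_ ?_)
    · exact (E.cls_eq_cls_iff _ _).1 (Quotient.sound hf)
    · exact (E.cls_eq_cls_iff _ _).1 (Quotient.sound hg))

/-- The `⋆₀`-composition of classes. -/
def qhcomp (E : C.Congruence) {a b c : C.Cell0} {p q : a ⟶ b} {p' q' : b ⟶ c}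
    (f : E.QuotCell p q) (g : E.QuotCell p' q') : E.QuotCell (p ≫ p') (q ≫ q') :=
  Quotient.liftOn₂ f g (fun f g => E.cls (C.hcomp f g)) (by
    intro f g f' g' hf hg
    refine (E.cls_eq_cls_iff _ _).2 (E.hcomp ?_ ?_)
    · exact (E.cls_eq_cls_iff _ _).1 (Quotient.sound hf)
    · exact (E.cls_eq_cls_iff _ _).1 (Quotient.sound hg))

theorem qvcomp_cls (E : C.Congruence) {a b : C.Cell0} {p q r : a ⟶ b} (f : C.Cell2 p q)
    (g : C.Cell2 q r) : E.qvcomp (E.cls f) (E.cls g) = E.cls (C.vcomp f g) := rfl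

theorem qhcomp_cls (E : C.Congruence) {a b c : C.Cell0} {p q : a ⟶ b} {p' q' : b ⟶ c}
    (f : C.Cell2 p q) (g : C.Cell2 p' q') :
    E.qhcomp (E.cls f) (E.cls g) = E.cls (C.hcomp f g) := rfl

/-- The quotient of a linear (2,2)-category by a congruence on its 2-cells. -/
def quotient (E : C.Congruence) : LinearTwoCat K where
  Cell0 := C.Cell0
  Cell2 p q := E.QuotCell p q
  id2 p := E.cls (C.id2 p)
  vcomp f g := E.qvcomp f g
  hcomp f g := E.qhcomp f g
  id2_vcomp f := by
    obtain ⟨f, rfl⟩ := E.cls_surjective f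
    rw [qvcomp_cls, C.id2_vcomp]
  vcomp_id2 f := by
    obtain ⟨f, rfl⟩ := E.cls_surjective f
    rw [qvcomp_cls, C.vcomp_id2]
  vcomp_assoc f g h := by
    obtain ⟨f, rfl⟩ := E.cls_surjective f
    obtain ⟨g, rfl⟩ := E.cls_surjective g
    obtain ⟨h, rfl⟩ := E.cls_surjective h
    simp only [qvcomp_cls, C.vcomp_assoc]
  hcomp_id2 p q := by rw [qhcomp_cls, C.hcomp_id2]
  exchange f g f' g' := by
    obtain ⟨f, rfl⟩ := E.cls_surjective f
    obtain ⟨g, rfl⟩ := E.cls_surjective g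
    obtain ⟨f', rfl⟩ := E.cls_surjective f'
    obtain ⟨g', rfl⟩ := E.cls_surjective g'
    simp only [qvcomp_cls, qhcomp_cls, C.exchange]
  id_hcomp f := by
    obtain ⟨f, rfl⟩ := E.cls_surjective f
    rw [qhcomp_cls]
    exact E.cls_heq (Category.id_comp _) (Category.id_comp _) (C.id_hcomp f)
  hcomp_id f := by
    obtain ⟨f, rfl⟩ := E.cls_surjective f
    rw [qhcomp_cls]
    exact E.cls_heq (Category.comp_id _) (Category.comp_id _) (C.hcomp_id f)
  hcomp_assoc f g h := by
    obtain ⟨f, rfl⟩ := E.cls_surjective f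
    obtain ⟨g, rfl⟩ := E.cls_surjective g
    obtain ⟨h, rfl⟩ := E.cls_surjective h
    simp only [qhcomp_cls]
    exact E.cls_heq (Category.assoc _ _ _) (Category.assoc _ _ _) (C.hcomp_assoc f g h)
  add_vcomp f f' g := by
    obtain ⟨f, rfl⟩ := E.cls_surjective f
    obtain ⟨f', rfl⟩ := E.cls_surjective f'
    obtain ⟨g, rfl⟩ := E.cls_surjective g
    exact congrArg E.cls (C.add_vcomp f f' g)
  vcomp_add f g g' := by
    obtain ⟨f, rfl⟩ := E.cls_surjective f
    obtain ⟨g, rfl⟩ := E.cls_surjective g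
    obtain ⟨g', rfl⟩ := E.cls_surjective g'
    exact congrArg E.cls (C.vcomp_add f g g')
  smul_vcomp c f g := by
    obtain ⟨f, rfl⟩ := E.cls_surjective f
    obtain ⟨g, rfl⟩ := E.cls_surjective g
    exact congrArg E.cls (C.smul_vcomp c f g)
  vcomp_smul c f g := by
    obtain ⟨f, rfl⟩ := E.cls_surjective f
    obtain ⟨g, rfl⟩ := E.cls_surjective g
    exact congrArg E.cls (C.vcomp_smul c f g)
  add_hcomp f f' g := by
    obtain ⟨f, rfl⟩ := E.cls_surjective f
    obtain ⟨f', rfl⟩ := E.cls_surjective f'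
    obtain ⟨g, rfl⟩ := E.cls_surjective g
    exact congrArg E.cls (C.add_hcomp f f' g)
  hcomp_add f g g' := by
    obtain ⟨f, rfl⟩ := E.cls_surjective f
    obtain ⟨g, rfl⟩ := E.cls_surjective g
    obtain ⟨g', rfl⟩ := E.cls_surjective g'
    exact congrArg E.cls (C.hcomp_add f g g')
  smul_hcomp c f g := by
    obtain ⟨f, rfl⟩ := E.cls_surjective f
    obtain ⟨g, rfl⟩ := E.cls_surjective g
    exact congrArg E.cls (C.smul_hcomp c f g)
  hcomp_smul c f g := by
    obtain ⟨f, rfl⟩ := E.cls_surjective f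
    obtain ⟨g, rfl⟩ := E.cls_surjective g
    exact congrArg E.cls (C.hcomp_smul c f g)

end Congruence

end LinearTwoCat

/-! ## The free 2-category on a 2-polygraph with one 0-cell -/

/-- A 2-polygraph with a single 0-cell `∗`: a type of generating 1-cells `∗ → ∗`, and a type of
generating 2-cells with their 1-source and 1-target in the free category on the generating 1-cells,
whose 1-cells are the words (lists) in the generating 1-cells. -/
structure TwoPolygraph where
  Gen1 : Type u
  Gen2 : Type v
  src : Gen2 → List Gen1
  tgt : Gen2 → List Gen1

/-- The type of 0-cells: it has the single element `∗`. -/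
inductive TwoPolygraph.ZeroCell (S : TwoPolygraph.{u, v}) : Type
  | star : TwoPolygraph.ZeroCell S

/-- The free category on the generating 1-cells: 1-cells are words, composed by concatenation. -/
instance (S : TwoPolygraph.{u, v}) : Category.{u} S.ZeroCell where
  Hom _ _ := List S.Gen1
  id _ := []
  comp p q := p ++ q
  id_comp p := List.nil_append p
  comp_id p := List.append_nil p
  assoc p q r := List.append_assoc p q r

namespace TwoPolygraph

variable (S : TwoPolygraph.{u, v})

/-- The 2-cells `left ⋆₀ gen ⋆₀ right : p → q` of the free 2-category, where `gen` is a generating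
2-cell and `left`, `right` are 1-cells. -/
@[ext]
structure Layer (p q : List S.Gen1) where
  left : List S.Gen1
  gen : S.Gen2
  right : List S.Gen1
  src_eq : p = left ++ S.src gen ++ right
  tgt_eq : q = left ++ S.tgt gen ++ right

/-- Sequences of `⋆₁`-composable layers (read from bottom, i.e. source, to top, i.e. target). -/
inductive Word : List S.Gen1 → List S.Gen1 → Type (max u v)
  | nil (p : List S.Gen1) : Word p p
  | cons {p q r : List S.Gen1} : S.Layer p q → Word q r → Word p r

variable {S}

namespace Layer

/-- `c ⋆₀ l`, for a 1-cell `c` -/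
def whiskerLeft (c : List S.Gen1) {p q : List S.Gen1} (l : S.Layer p q) :
    S.Layer (c ++ p) (c ++ q) where
  left := c ++ l.left
  gen := l.gen
  right := l.right
  src_eq := (congrArg (c ++ ·) l.src_eq).trans (by simp)
  tgt_eq := (congrArg (c ++ ·) l.tgt_eq).trans (by simp)

/-- `l ⋆₀ c`, for a 1-cell `c` -/
def whiskerRight {p q : List S.Gen1} (l : S.Layer p q) (c : List S.Gen1) :
    S.Layer (p ++ c) (q ++ c) where
  left := l.left
  gen := l.gen
  right := l.right ++ c
  src_eq := (congrArg (· ++ c) l.src_eq).trans (by simp)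
  tgt_eq := (congrArg (· ++ c) l.tgt_eq).trans (by simp)

theorem heq_of {p q p' q' : List S.Gen1} (hp : p = p') (hq : q = q') {l : S.Layer p q}
    {l' : S.Layer p' q'} (h1 : l.left = l'.left) (h2 : l.gen = l'.gen)
    (h3 : l.right = l'.right) : HEq l l' := by
  subst hp hq
  exact heq_of_eq (Layer.ext h1 h2 h3)

end Layer

namespace Word

/-- Vertical concatenation. -/
def append : ∀ {p q r : List S.Gen1}, S.Word p q → S.Word q r → S.Word p r
  | _, _, _, nil _, g => g
  | _, _, _, cons l f, g => cons l (append f g)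

/-- `c ⋆₀ f`, for a 1-cell `c` -/
def whiskerLeft (c : List S.Gen1) : ∀ {p q : List S.Gen1}, S.Word p q → S.Word (c ++ p) (c ++ q)
  | _, _, nil p => nil (c ++ p)
  | _, _, cons l f => cons (l.whiskerLeft c) (whiskerLeft c f)

/-- `f ⋆₀ c`, for a 1-cell `c` -/
def whiskerRight : ∀ {p q : List S.Gen1}, S.Word p q → (c : List S.Gen1) → S.Word (p ++ c) (q ++ c)
  | _, _, nil p, c => nil (p ++ c)
  | _, _, cons l f, c => cons (l.whiskerRight c) (whiskerRight f c)

theorem append_nil {p q : List S.Gen1} (f : S.Word p q) : f.append (nil q) = f := by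
  induction f with
  | nil p => rfl
  | cons l f ih => exact congrArg (cons l) ih

theorem append_assoc {p q r s : List S.Gen1} (f : S.Word p q) (g : S.Word q r) (h : S.Word r s) :
    (f.append g).append h = f.append (g.append h) := by
  induction f with
  | nil p => rfl
  | cons l f ih => exact congrArg (cons l) (ih g)

theorem whiskerLeft_append (c : List S.Gen1) {p q r : List S.Gen1} (f : S.Word p q)
    (g : S.Word q r) :
    (f.append g).whiskerLeft c = (f.whiskerLeft c).append (g.whiskerLeft c) := by
  induction f with
  | nil p => rfl
  | cons l f ih => exact congrArg (cons _) (ih g)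

theorem whiskerRight_append (c : List S.Gen1) {p q r : List S.Gen1} (f : S.Word p q)
    (g : S.Word q r) :
    (f.append g).whiskerRight c = (f.whiskerRight c).append (g.whiskerRight c) := by
  induction f with
  | nil p => rfl
  | cons l f ih => exact congrArg (cons _) (ih g)

theorem cons_heq {p q r p' q' r' : List S.Gen1} (hp : p = p') (hq : q = q') (hr : r = r')
    {l : S.Layer p q} {l' : S.Layer p' q'} {f : S.Word q r} {f' : S.Word q' r'} (hl : HEq l l')
    (hf : HEq f f') : HEq (cons l f) (cons l' f') := by
  subst hp hq hr
  rw [eq_of_heq hl, eq_of_heq hf]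

theorem nil_heq {p p' : List S.Gen1} (hp : p = p') : HEq (nil (S := S) p) (nil (S := S) p') := by
  rw [hp]

theorem nil_whiskerLeft {p q : List S.Gen1} (f : S.Word p q) : f.whiskerLeft [] = f := by
  induction f with
  | nil p => rfl
  | cons l f ih => exact congrArg (cons _) ih

theorem whiskerRight_nil {p q : List S.Gen1} (f : S.Word p q) : HEq (f.whiskerRight []) f := by
  induction f with
  | nil p => exact nil_heq (by simp)
  | cons l f ih =>
    exact cons_heq (by simp) (by simp) (by simp)
      (Layer.heq_of (by simp) (by simp) rfl rfl (by simp [Layer.whiskerRight])) ih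

theorem whiskerLeft_whiskerLeft (c d : List S.Gen1) {p q : List S.Gen1} (f : S.Word p q) :
    HEq (f.whiskerLeft (c ++ d)) ((f.whiskerLeft d).whiskerLeft c) := by
  induction f with
  | nil p => exact nil_heq (by simp)
  | cons l f ih =>
    exact cons_heq (by simp) (by simp) (by simp)
      (Layer.heq_of (by simp) (by simp) (by simp [Layer.whiskerLeft]) rfl rfl) ih

theorem whiskerRight_whiskerRight (c d : List S.Gen1) {p q : List S.Gen1} (f : S.Word p q) :
    HEq ((f.whiskerRight c).whiskerRight d) (f.whiskerRight (c ++ d)) := by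
  induction f with
  | nil p => exact nil_heq (by simp)
  | cons l f ih =>
    exact cons_heq (by simp) (by simp) (by simp)
      (Layer.heq_of (by simp) (by simp) rfl rfl (by simp [Layer.whiskerRight])) ih

theorem whiskerLeft_whiskerRight (c d : List S.Gen1) {p q : List S.Gen1} (f : S.Word p q) :
    HEq ((f.whiskerLeft c).whiskerRight d) ((f.whiskerRight d).whiskerLeft c) := by
  induction f with
  | nil p => exact nil_heq (by simp)
  | cons l f ih =>
    exact cons_heq (by simp) (by simp) (by simp)
      (Layer.heq_of (by simp) (by simp) rfl rfl rfl) ih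

/-- One application of an exchange relation to two consecutive layers of a word: if two
generating 2-cells `g` and `h` act on disjoint parts of a 1-cell, with `g` on the left of `h`,
then applying `g` first and `h` next is the same as applying `h` first and `g` next. -/
inductive Exchange : ∀ {p q : List S.Gen1}, S.Word p q → S.Word p q → Prop
  | swap (a b c : List S.Gen1) (g h : S.Gen2) {p m m' q r : List S.Gen1}
      (h₁ : p = a ++ S.src g ++ (b ++ S.src h ++ c))
      (h₂ : m = a ++ S.tgt g ++ (b ++ S.src h ++ c))
      (h₃ : m = (a ++ S.tgt g ++ b) ++ S.src h ++ c)
      (h₄ : q = (a ++ S.tgt g ++ b) ++ S.tgt h ++ c)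
      (h₅ : p = (a ++ S.src g ++ b) ++ S.src h ++ c)
      (h₆ : m' = (a ++ S.src g ++ b) ++ S.tgt h ++ c)
      (h₇ : m' = a ++ S.src g ++ (b ++ S.tgt h ++ c))
      (h₈ : q = a ++ S.tgt g ++ (b ++ S.tgt h ++ c))
      (f : S.Word q r) :
      Exchange
        (cons ⟨a, g, b ++ S.src h ++ c, h₁, h₂⟩ (cons ⟨a ++ S.tgt g ++ b, h, c, h₃, h₄⟩ f))
        (cons ⟨a ++ S.src g ++ b, h, c, h₅, h₆⟩ (cons ⟨a, g, b ++ S.tgt h ++ c, h₇, h₈⟩ f))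
  | cons {p q r : List S.Gen1} (l : S.Layer p q) {f f' : S.Word q r} :
      Exchange f f' → Exchange (Word.cons l f) (Word.cons l f')

end Word

variable (S)

/-- The 2-cells of the free 2-category on the 2-polygraph: sequences of layers modulo the exchange
relations.  These are the monomials. -/
def Mono (p q : List S.Gen1) : Type (max u v) :=
  Quot (Word.Exchange (S := S) (p := p) (q := q))

variable {S}

namespace Word

theorem Exchange.append_right {p q r : List S.Gen1} {f f' : S.Word p q} (h : Exchange f f')
    (g : S.Word q r) : Exchange (f.append g) (f'.append g) := by
  induction h with
  | swap a b c x y h₁ h₂ h₃ h₄ h₅ h₆ h₇ h₈ f =>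
    exact Exchange.swap a b c x y h₁ h₂ h₃ h₄ h₅ h₆ h₇ h₈ (f.append g)
  | cons l _ ih => exact Exchange.cons l (ih g)

theorem Exchange.append_left {p q r : List S.Gen1} (f : S.Word p q) {g g' : S.Word q r}
    (h : Exchange g g') : Exchange (f.append g) (f.append g') := by
  induction f with
  | nil p => exact h
  | cons l f ih => exact Exchange.cons l (ih h)

theorem cons_cons_congr {p m q r : List S.Gen1} {l l' : S.Layer p m} {k k' : S.Layer m q}
    (f : S.Word q r) (h : l = l') (h' : k = k') :
    Word.cons l (Word.cons k f) = Word.cons l' (Word.cons k' f) := by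
  rw [h, h']

theorem Exchange.whiskerLeft (d : List S.Gen1) {p q : List S.Gen1} {f f' : S.Word p q}
    (h : Exchange f f') : Exchange (f.whiskerLeft d) (f'.whiskerLeft d) := by
  induction h with
  | swap a b c x y h₁ h₂ h₃ h₄ h₅ h₆ h₇ h₈ f =>
    have key := Exchange.swap (d ++ a) b c x y (congrArg (d ++ ·) h₁ |>.trans (by simp))
      (congrArg (d ++ ·) h₂ |>.trans (by simp)) (congrArg (d ++ ·) h₃ |>.trans (by simp))
      (congrArg (d ++ ·) h₄ |>.trans (by simp)) (congrArg (d ++ ·) h₅ |>.trans (by simp))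
      (congrArg (d ++ ·) h₆ |>.trans (by simp)) (congrArg (d ++ ·) h₇ |>.trans (by simp))
      (congrArg (d ++ ·) h₈ |>.trans (by simp)) (f.whiskerLeft d)
    convert key using 1
    · exact cons_cons_congr _ (Layer.ext rfl rfl rfl)
        (Layer.ext (by simp [Layer.whiskerLeft]) rfl rfl)
    · exact cons_cons_congr _ (Layer.ext (by simp [Layer.whiskerLeft]) rfl rfl)
        (Layer.ext rfl rfl rfl)
  | cons l _ ih => exact Exchange.cons _ ih

theorem Exchange.whiskerRight (d : List S.Gen1) {p q : List S.Gen1} {f f' : S.Word p q}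
    (h : Exchange f f') : Exchange (f.whiskerRight d) (f'.whiskerRight d) := by
  induction h with
  | swap a b c x y h₁ h₂ h₃ h₄ h₅ h₆ h₇ h₈ f =>
    have key := Exchange.swap a b (c ++ d) x y (congrArg (· ++ d) h₁ |>.trans (by simp))
      (congrArg (· ++ d) h₂ |>.trans (by simp)) (congrArg (· ++ d) h₃ |>.trans (by simp))
      (congrArg (· ++ d) h₄ |>.trans (by simp)) (congrArg (· ++ d) h₅ |>.trans (by simp))
      (congrArg (· ++ d) h₆ |>.trans (by simp)) (congrArg (· ++ d) h₇ |>.trans (by simp))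
      (congrArg (· ++ d) h₈ |>.trans (by simp)) (f.whiskerRight d)
    convert key using 1
    · exact cons_cons_congr _ (Layer.ext rfl rfl (by simp [Layer.whiskerRight]))
        (Layer.ext rfl rfl rfl)
    · exact cons_cons_congr _ (Layer.ext rfl rfl rfl)
        (Layer.ext rfl rfl (by simp [Layer.whiskerRight]))
  | cons l _ ih => exact Exchange.cons _ ih

end Word

namespace Mono

/-- The class of a word. -/
def mk {p q : List S.Gen1} (f : S.Word p q) : S.Mono p q := Quot.mk _ f

/-- The identity 2-cell of a 1-cell. -/
def id (p : List S.Gen1) : S.Mono p p := mk (Word.nil p)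

/-- A generating 2-cell. -/
def gen (g : S.Gen2) : S.Mono (S.src g) (S.tgt g) :=
  mk (Word.cons ⟨[], g, [], by simp, by simp⟩ (Word.nil _))

/-- The composition `⋆₁` of 2-cells. -/
def vcomp {p q r : List S.Gen1} (f : S.Mono p q) (g : S.Mono q r) : S.Mono p r :=
  Quot.liftOn f
    (fun f => Quot.liftOn g (fun g => mk (f.append g))
      fun _ _ h => Quot.sound (h.append_left f))
    fun _ _ h => by
      induction g using Quot.ind
      exact Quot.sound (h.append_right _)

/-- `c ⋆₀ f`, for a 1-cell `c` -/
def whiskerLeft (c : List S.Gen1) {p q : List S.Gen1} (f : S.Mono p q) :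
    S.Mono (c ++ p) (c ++ q) :=
  Quot.liftOn f (fun f => mk (f.whiskerLeft c)) fun _ _ h => Quot.sound (h.whiskerLeft c)

/-- `f ⋆₀ c`, for a 1-cell `c` -/
def whiskerRight {p q : List S.Gen1} (f : S.Mono p q) (c : List S.Gen1) :
    S.Mono (p ++ c) (q ++ c) :=
  Quot.liftOn f (fun f => mk (f.whiskerRight c)) fun _ _ h => Quot.sound (h.whiskerRight c)

/-- The composition `⋆₀` of 2-cells: `f` on the left of `g`. -/
def hcomp {p q p' q' : List S.Gen1} (f : S.Mono p q) (g : S.Mono p' q') :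
    S.Mono (p ++ p') (q ++ q') :=
  (f.whiskerRight p').vcomp (g.whiskerLeft q)

theorem exists_rep {p q : List S.Gen1} (f : S.Mono p q) : ∃ g : S.Word p q, mk g = f :=
  Quot.exists_rep f

theorem id_vcomp {p q : List S.Gen1} (f : S.Mono p q) : (id p).vcomp f = f := by
  obtain ⟨f, rfl⟩ := f.exists_rep
  rfl

theorem vcomp_id {p q : List S.Gen1} (f : S.Mono p q) : f.vcomp (id q) = f := by
  obtain ⟨f, rfl⟩ := f.exists_rep
  exact congrArg mk f.append_nil

theorem vcomp_assoc {p q r s : List S.Gen1} (f : S.Mono p q) (g : S.Mono q r) (h : S.Mono r s) :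
    (f.vcomp g).vcomp h = f.vcomp (g.vcomp h) := by
  obtain ⟨f, rfl⟩ := f.exists_rep
  obtain ⟨g, rfl⟩ := g.exists_rep
  obtain ⟨h, rfl⟩ := h.exists_rep
  exact congrArg mk (f.append_assoc g h)

theorem whiskerLeft_vcomp (c : List S.Gen1) {p q r : List S.Gen1} (f : S.Mono p q)
    (g : S.Mono q r) : (f.vcomp g).whiskerLeft c = (f.whiskerLeft c).vcomp (g.whiskerLeft c) := by
  obtain ⟨f, rfl⟩ := f.exists_rep
  obtain ⟨g, rfl⟩ := g.exists_rep
  exact congrArg mk (f.whiskerLeft_append c g)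

theorem whiskerRight_vcomp (c : List S.Gen1) {p q r : List S.Gen1} (f : S.Mono p q)
    (g : S.Mono q r) :
    (f.vcomp g).whiskerRight c = (f.whiskerRight c).vcomp (g.whiskerRight c) := by
  obtain ⟨f, rfl⟩ := f.exists_rep
  obtain ⟨g, rfl⟩ := g.exists_rep
  exact congrArg mk (f.whiskerRight_append c g)

theorem mk_cons {p q r : List S.Gen1} (l : S.Layer p q) (f : S.Word q r) :
    mk (Word.cons l f) = (mk (Word.cons l (Word.nil _))).vcomp (mk f) := rfl

theorem layer_exchange {p q p' q' : List S.Gen1} (l : S.Layer p q) (k : S.Layer p' q') :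
    ((mk (Word.cons l (Word.nil _))).whiskerRight p').vcomp
        ((mk (Word.cons k (Word.nil _))).whiskerLeft q) =
      ((mk (Word.cons k (Word.nil _))).whiskerLeft p).vcomp
        ((mk (Word.cons l (Word.nil _))).whiskerRight q') := by
  obtain ⟨a, g, b, hp, hq⟩ := l
  obtain ⟨b', h, c, hp', hq'⟩ := k
  subst hp hq hp' hq'
  have key := Word.Exchange.swap a (b ++ b') c g h
    (p := a ++ S.src g ++ b ++ (b' ++ S.src h ++ c))
    (m := a ++ S.tgt g ++ b ++ (b' ++ S.src h ++ c))
    (m' := a ++ S.src g ++ b ++ (b' ++ S.tgt h ++ c))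
    (q := a ++ S.tgt g ++ b ++ (b' ++ S.tgt h ++ c))
    (by simp) (by simp) (by simp) (by simp) (by simp) (by simp) (by simp) (by simp)
    (Word.nil _)
  have key' := Quot.sound key
  refine Eq.trans ?_ (key'.trans ?_)
  · exact congrArg mk (Word.cons_cons_congr _
      (Layer.ext rfl rfl (by simp [Layer.whiskerRight]))
      (Layer.ext (by simp [Layer.whiskerLeft]) rfl rfl))
  · exact congrArg mk (Word.cons_cons_congr _
      (Layer.ext (by simp [Layer.whiskerLeft]) rfl rfl)
      (Layer.ext rfl rfl (by simp [Layer.whiskerRight])))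

theorem whisker_exchange {p q p' q' : List S.Gen1} (f : S.Mono p q) (g : S.Mono p' q') :
    (f.whiskerRight p').vcomp (g.whiskerLeft q) = (g.whiskerLeft p).vcomp (f.whiskerRight q') := by
  obtain ⟨f, rfl⟩ := f.exists_rep
  obtain ⟨g, rfl⟩ := g.exists_rep
  induction f with
  | nil p => exact (id_vcomp _).trans (vcomp_id _).symm
  | cons l f ih =>
    have step : ∀ {p q : List S.Gen1} (l : S.Layer p q),
        ((mk (Word.cons l (Word.nil _))).whiskerRight p').vcomp ((mk g).whiskerLeft q) =
        ((mk g).whiskerLeft p).vcomp ((mk (Word.cons l (Word.nil _))).whiskerRight q') := by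
      intro p q l
      clear ih
      induction g with
      | nil p => exact (vcomp_id _).trans (id_vcomp _).symm
      | cons k g ih =>
        rw [mk_cons k g, whiskerLeft_vcomp, whiskerLeft_vcomp, ← vcomp_assoc, layer_exchange,
          vcomp_assoc, ih, vcomp_assoc]
    rw [mk_cons l f, whiskerRight_vcomp, whiskerRight_vcomp, vcomp_assoc, ih, ← vcomp_assoc,
      step, vcomp_assoc]

theorem hcomp_id (p q : List S.Gen1) : (id p).hcomp (id q) = id (p ++ q) := rfl

theorem exchange {p q r p' q' r' : List S.Gen1} (f : S.Mono p q) (g : S.Mono q r)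
    (f' : S.Mono p' q') (g' : S.Mono q' r') :
    (f.vcomp g).hcomp (f'.vcomp g') = (f.hcomp f').vcomp (g.hcomp g') := by
  unfold hcomp
  rw [whiskerRight_vcomp, whiskerLeft_vcomp, vcomp_assoc, vcomp_assoc,
    ← vcomp_assoc (whiskerRight g p'), whisker_exchange g f', vcomp_assoc]

theorem mk_heq {p q p' q' : List S.Gen1} (hp : p = p') (hq : q = q') {f : S.Word p q}
    {g : S.Word p' q'} (h : HEq f g) : HEq (mk f) (mk g) := by
  subst hp hq
  rw [eq_of_heq h]

theorem vcomp_heq {p q r p' q' r' : List S.Gen1} (hp : p = p') (hq : q = q') (hr : r = r')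
    {f : S.Mono p q} {f' : S.Mono p' q'} {g : S.Mono q r} {g' : S.Mono q' r'} (hf : HEq f f')
    (hg : HEq g g') : HEq (f.vcomp g) (f'.vcomp g') := by
  subst hp hq hr
  rw [eq_of_heq hf, eq_of_heq hg]

theorem nil_hcomp {p q : List S.Gen1} (f : S.Mono p q) : (id []).hcomp f = f := by
  obtain ⟨f, rfl⟩ := f.exists_rep
  exact congrArg mk f.nil_whiskerLeft

theorem hcomp_nil {p q : List S.Gen1} (f : S.Mono p q) : HEq (f.hcomp (id [])) f := by
  have h : f.hcomp (id []) = f.whiskerRight [] := vcomp_id _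
  rw [h]
  obtain ⟨f, rfl⟩ := f.exists_rep
  exact mk_heq (by simp) (by simp) f.whiskerRight_nil

theorem hcomp_assoc {p q p' q' p'' q'' : List S.Gen1} (f : S.Mono p q) (g : S.Mono p' q')
    (h : S.Mono p'' q'') : HEq ((f.hcomp g).hcomp h) (f.hcomp (g.hcomp h)) := by
  unfold hcomp
  rw [whiskerRight_vcomp, whiskerLeft_vcomp, vcomp_assoc]
  refine vcomp_heq (by simp) (by simp) (by simp) ?_
    (vcomp_heq (by simp) (by simp) (by simp) ?_ ?_)
  · obtain ⟨f, rfl⟩ := f.exists_rep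
    exact mk_heq (by simp) (by simp) (f.whiskerRight_whiskerRight _ _)
  · obtain ⟨g, rfl⟩ := g.exists_rep
    exact mk_heq (by simp) (by simp) (g.whiskerLeft_whiskerRight _ _)
  · obtain ⟨h, rfl⟩ := h.exists_rep
    exact mk_heq (by simp) (by simp) (h.whiskerLeft_whiskerLeft _ _)

end Mono

/-! ## The free linear (2,2)-category on a 2-polygraph -/

variable (S) (K : Type x) [Field K]

/-- The 2-cells of the free linear (2,2)-category: linear combinations of monomials. The monomial
decomposition of such a 2-cell is its expansion as a finitely supported function. -/
abbrev LCell (p q : List S.Gen1) : Type (max u v x) := S.Mono p q →₀ K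

end TwoPolygraph

/-- The bilinear extension of a map `op : A → B → C`:
`(∑ xₐ a, ∑ y_b b) ↦ ∑ xₐ y_b op a b`. -/
noncomputable def bilinearExtension (K : Type x) [Field K] {A : Type u} {B : Type v} {C : Type w}
    (op : A → B → C) : (A →₀ K) →ₗ[K] (B →₀ K) →ₗ[K] (C →₀ K) :=
  Finsupp.linearCombination K (fun a => Finsupp.lmapDomain K K (op a))

theorem bilinearExtension_single (K : Type x) [Field K] {A : Type u} {B : Type v} {C : Type w}
    (op : A → B → C) (a : A) (b : B) (s t : K) :
    bilinearExtension K op (Finsupp.single a s) (Finsupp.single b t) =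
      Finsupp.single (op a b) (s * t) := by
  simp [bilinearExtension, Finsupp.mapDomain_single]

namespace TwoPolygraph

namespace LCell

variable {S : TwoPolygraph.{u, v}} {K : Type x} [Field K]

/-- A monomial, as a 2-cell of the free linear (2,2)-category. -/
noncomputable def of (K : Type x) [Field K] {p q : List S.Gen1} (m : S.Mono p q) : S.LCell K p q :=
  Finsupp.single m 1

/-- The composition `⋆₁`. -/
noncomputable def vcomp {p q r : List S.Gen1} (f : S.LCell K p q) (g : S.LCell K q r) :
    S.LCell K p r :=
  bilinearExtension K Mono.vcomp f g

/-- The composition `⋆₀`. -/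
noncomputable def hcomp {p q p' q' : List S.Gen1} (f : S.LCell K p q) (g : S.LCell K p' q') :
    S.LCell K (p ++ p') (q ++ q') :=
  bilinearExtension K Mono.hcomp f g

theorem vcomp_single {p q r : List S.Gen1} (f : S.Mono p q) (g : S.Mono q r) (s t : K) :
    vcomp (Finsupp.single f s : S.LCell K p q) (Finsupp.single g t : S.LCell K q r) =
      Finsupp.single (f.vcomp g) (s * t) :=
  bilinearExtension_single K _ f g s t

theorem hcomp_single {p q p' q' : List S.Gen1} (f : S.Mono p q) (g : S.Mono p' q') (s t : K) :
    hcomp (Finsupp.single f s : S.LCell K p q) (Finsupp.single g t : S.LCell K p' q') =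
      Finsupp.single (f.hcomp g) (s * t) :=
  bilinearExtension_single K _ f g s t

theorem add_vcomp {p q r : List S.Gen1} (f f' : S.LCell K p q) (g : S.LCell K q r) :
    vcomp (f + f') g = vcomp f g + vcomp f' g := by simp [vcomp]

theorem vcomp_add {p q r : List S.Gen1} (f : S.LCell K p q) (g g' : S.LCell K q r) :
    vcomp f (g + g') = vcomp f g + vcomp f g' := by simp [vcomp]

theorem smul_vcomp {p q r : List S.Gen1} (c : K) (f : S.LCell K p q) (g : S.LCell K q r) :
    vcomp (c • f) g = c • vcomp f g := by simp [vcomp]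

theorem vcomp_smul {p q r : List S.Gen1} (c : K) (f : S.LCell K p q) (g : S.LCell K q r) :
    vcomp f (c • g) = c • vcomp f g := by simp [vcomp]

theorem zero_vcomp {p q r : List S.Gen1} (g : S.LCell K q r) :
    vcomp (0 : S.LCell K p q) g = 0 := by simp [vcomp]

theorem vcomp_zero {p q r : List S.Gen1} (f : S.LCell K p q) :
    vcomp f (0 : S.LCell K q r) = 0 := by simp [vcomp]

theorem add_hcomp {p q p' q' : List S.Gen1} (f f' : S.LCell K p q) (g : S.LCell K p' q') :
    hcomp (f + f') g = hcomp f g + hcomp f' g := by simp [hcomp]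

theorem hcomp_add {p q p' q' : List S.Gen1} (f : S.LCell K p q) (g g' : S.LCell K p' q') :
    hcomp f (g + g') = hcomp f g + hcomp f g' := by simp [hcomp]

theorem smul_hcomp {p q p' q' : List S.Gen1} (c : K) (f : S.LCell K p q) (g : S.LCell K p' q') :
    hcomp (c • f) g = c • hcomp f g := by simp [hcomp]

theorem hcomp_smul {p q p' q' : List S.Gen1} (c : K) (f : S.LCell K p q) (g : S.LCell K p' q') :
    hcomp f (c • g) = c • hcomp f g := by simp [hcomp]

theorem zero_hcomp {p q p' q' : List S.Gen1} (g : S.LCell K p' q') :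
    hcomp (0 : S.LCell K p q) g = 0 := by simp [hcomp]

theorem hcomp_zero {p q p' q' : List S.Gen1} (f : S.LCell K p q) :
    hcomp f (0 : S.LCell K p' q') = 0 := by simp [hcomp]

theorem single_heq {p q p' q' : List S.Gen1} (hp : p = p') (hq : q = q') {f : S.Mono p q}
    {g : S.Mono p' q'} (h : HEq f g) (s : K) :
    HEq (Finsupp.single f s : S.LCell K p q) (Finsupp.single g s : S.LCell K p' q') := by
  subst hp hq
  rw [eq_of_heq h]

theorem add_heq {p q p' q' : List S.Gen1} (hp : p = p') (hq : q = q') {f g : S.LCell K p q}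
    {f' g' : S.LCell K p' q'} (h : HEq f f') (h' : HEq g g') : HEq (f + g) (f' + g') := by
  subst hp hq
  rw [eq_of_heq h, eq_of_heq h']

theorem zero_heq {p q p' q' : List S.Gen1} (hp : p = p') (hq : q = q') :
    HEq (0 : S.LCell K p q) (0 : S.LCell K p' q') := by
  subst hp hq
  rfl

theorem id_vcomp {p q : List S.Gen1} (f : S.LCell K p q) : vcomp (of K (Mono.id p)) f = f := by
  induction f using Finsupp.induction_linear with
  | zero => exact vcomp_zero _
  | add f g hf hg => rw [vcomp_add, hf, hg]
  | single m t => rw [of, vcomp_single, Mono.id_vcomp, one_mul]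

theorem vcomp_id {p q : List S.Gen1} (f : S.LCell K p q) : vcomp f (of K (Mono.id q)) = f := by
  induction f using Finsupp.induction_linear with
  | zero => exact zero_vcomp _
  | add f g hf hg => rw [add_vcomp, hf, hg]
  | single m t => rw [of, vcomp_single, Mono.vcomp_id, mul_one]

theorem vcomp_assoc {p q r s : List S.Gen1} (f : S.LCell K p q) (g : S.LCell K q r)
    (h : S.LCell K r s) : vcomp (vcomp f g) h = vcomp f (vcomp g h) := by
  induction f using Finsupp.induction_linear with
  | zero => simp only [zero_vcomp]
  | add f f' hf hf' => simp only [add_vcomp, hf, hf']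
  | single a x =>
    induction g using Finsupp.induction_linear with
    | zero => simp only [zero_vcomp, vcomp_zero]
    | add g g' hg hg' => simp only [add_vcomp, vcomp_add, hg, hg']
    | single b y =>
      induction h using Finsupp.induction_linear with
      | zero => simp only [vcomp_zero]
      | add h h' hh hh' => simp only [vcomp_add, hh, hh']
      | single c z => simp only [vcomp_single, Mono.vcomp_assoc, mul_assoc]

theorem exchange {p q r p' q' r' : List S.Gen1} (f : S.LCell K p q) (g : S.LCell K q r)
    (f' : S.LCell K p' q') (g' : S.LCell K q' r') :
    hcomp (vcomp f g) (vcomp f' g') = vcomp (hcomp f f') (hcomp g g') := by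
  induction f using Finsupp.induction_linear with
  | zero => simp only [zero_vcomp, zero_hcomp]
  | add f₁ f₂ h₁ h₂ => simp only [add_vcomp, add_hcomp, h₁, h₂]
  | single a x =>
    induction g using Finsupp.induction_linear with
    | zero => simp only [zero_hcomp, vcomp_zero]
    | add f₁ f₂ h₁ h₂ => simp only [vcomp_add, add_hcomp, h₁, h₂]
    | single b y =>
      induction f' using Finsupp.induction_linear with
      | zero => simp only [zero_vcomp, hcomp_zero]
      | add f₁ f₂ h₁ h₂ => simp only [add_vcomp, hcomp_add, h₁, h₂]
      | single c z =>
        induction g' using Finsupp.induction_linear with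
        | zero => simp only [vcomp_zero, hcomp_zero]
        | add f₁ f₂ h₁ h₂ => simp only [vcomp_add, hcomp_add, h₁, h₂]
        | single d t =>
          simp only [vcomp_single, hcomp_single, Mono.exchange]
          rw [mul_mul_mul_comm]

theorem nil_hcomp {p q : List S.Gen1} (f : S.LCell K p q) :
    hcomp (of K (Mono.id [])) f = f := by
  induction f using Finsupp.induction_linear with
  | zero => exact hcomp_zero _
  | add f g hf hg => rw [hcomp_add, hf, hg]
  | single m t => rw [of, hcomp_single, Mono.nil_hcomp, one_mul]

theorem hcomp_nil {p q : List S.Gen1} (f : S.LCell K p q) :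
    HEq (hcomp f (of K (Mono.id []))) f := by
  induction f using Finsupp.induction_linear with
  | zero => rw [zero_hcomp]; exact zero_heq (by simp) (by simp)
  | add f g hf hg => rw [add_hcomp]; exact add_heq (by simp) (by simp) hf hg
  | single m t =>
    rw [of, hcomp_single, mul_one]
    exact single_heq (by simp) (by simp) m.hcomp_nil t

theorem hcomp_assoc {p q p' q' p'' q'' : List S.Gen1} (f : S.LCell K p q)
    (g : S.LCell K p' q') (h : S.LCell K p'' q'') :
    HEq (hcomp (hcomp f g) h) (hcomp f (hcomp g h)) := by
  induction f using Finsupp.induction_linear with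
  | zero => simp only [zero_hcomp]; exact zero_heq (by simp) (by simp)
  | add f f' hf hf' => simp only [add_hcomp]; exact add_heq (by simp) (by simp) hf hf'
  | single a x =>
    induction g using Finsupp.induction_linear with
    | zero => simp only [zero_hcomp, hcomp_zero]; exact zero_heq (by simp) (by simp)
    | add g g' hg hg' =>
      simp only [add_hcomp, hcomp_add]; exact add_heq (by simp) (by simp) hg hg'
    | single b y =>
      induction h using Finsupp.induction_linear with
      | zero => simp only [hcomp_zero]; exact zero_heq (by simp) (by simp)
      | add h h' hh hh' => simp only [hcomp_add]; exact add_heq (by simp) (by simp) hh hh'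
      | single c z =>
        simp only [hcomp_single, mul_assoc]
        exact single_heq (by simp) (by simp) (Mono.hcomp_assoc a b c) _

end LCell

/-- The free linear (2,2)-category on a 2-polygraph with one 0-cell. -/
noncomputable def freeLinear (S : TwoPolygraph.{u, v}) (K : Type x) [Field K] :
    LinearTwoCat.{0, u, max u v x, x} K where
  Cell0 := S.ZeroCell
  Cell2 p q := S.LCell K p q
  id2 p := LCell.of K (Mono.id p)
  vcomp f g := LCell.vcomp f g
  hcomp f g := LCell.hcomp f g
  id2_vcomp f := LCell.id_vcomp f
  vcomp_id2 f := LCell.vcomp_id f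
  vcomp_assoc f g h := LCell.vcomp_assoc f g h
  hcomp_id2 p q := by
    show LCell.hcomp (LCell.of K (Mono.id p)) (LCell.of K (Mono.id q)) = _
    rw [LCell.of, LCell.of, LCell.hcomp_single, Mono.hcomp_id, mul_one]
    rfl
  exchange f g f' g' := LCell.exchange f g f' g'
  id_hcomp f := heq_of_eq (LCell.nil_hcomp f)
  hcomp_id f := LCell.hcomp_nil f
  hcomp_assoc f g h := LCell.hcomp_assoc f g h
  add_vcomp := LCell.add_vcomp
  vcomp_add := LCell.vcomp_add
  smul_vcomp := LCell.smul_vcomp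
  vcomp_smul := LCell.vcomp_smul
  add_hcomp := LCell.add_hcomp
  hcomp_add := LCell.hcomp_add
  smul_hcomp := LCell.smul_hcomp
  hcomp_smul := LCell.hcomp_smul

end TwoPolygraph

/-! ## Linear (3,2)-polygraphs and rewriting -/

/-- A (left-monomial) linear (3,2)-polygraph with one 0-cell: a 2-polygraph together with
generating 3-cells, each of which has a monomial as 2-source and a parallel 2-cell of the free
linear (2,2)-category as 2-target. -/
structure LinearPolygraph (K : Type x) [Field K] where
  base : TwoPolygraph.{u, v}
  Gen3 : Type w
  src1 : Gen3 → List base.Gen1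
  tgt1 : Gen3 → List base.Gen1
  src2 : ∀ α : Gen3, base.Mono (src1 α) (tgt1 α)
  tgt2 : ∀ α : Gen3, base.LCell K (src1 α) (tgt1 α)

namespace TwoPolygraph

/-- A monomial context `m₁ ⋆₁ (m₂ ⋆₀ □ ⋆₀ m₃) ⋆₁ m₄ : p → q` with a hole `□ : r → s`, where
the `mᵢ` are monomials. -/
structure MonoContext (S : TwoPolygraph.{u, v}) (r s p q : List S.Gen1) where
  {a : List S.Gen1}
  {a' : List S.Gen1}
  {b : List S.Gen1}
  {b' : List S.Gen1}
  m₁ : S.Mono p (a ++ r ++ b)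
  m₂ : S.Mono a a'
  m₃ : S.Mono b b'
  m₄ : S.Mono (a' ++ s ++ b') q

namespace MonoContext

variable {S : TwoPolygraph.{u, v}} {r s p q : List S.Gen1}

/-- Filling the hole with a monomial. -/
def fill (C : S.MonoContext r s p q) (m : S.Mono r s) : S.Mono p q :=
  (C.m₁.vcomp ((C.m₂.hcomp m).hcomp C.m₃)).vcomp C.m₄

/-- Filling the hole with a 2-cell of the free linear (2,2)-category (the linear extension of
`fill`). -/
noncomputable def fillLinear {K : Type x} [Field K] (C : S.MonoContext r s p q)
    (f : S.LCell K r s) : S.LCell K p q :=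
  Finsupp.mapDomain C.fill f

end MonoContext

end TwoPolygraph

namespace LinearPolygraph

open TwoPolygraph

variable {K : Type x} [Field K] (P : LinearPolygraph.{u, v, w, x} K)

/-- `f → g` is a rewriting step: `f = c C[s(α)] + h` and `g = c C[t(α)] + h` for a generating 3-cell
`α`, a monomial context `C`, a nonzero scalar `c` and a 2-cell `h` such that the monomial
`C[s(α)]` does not appear in the monomial decomposition of `h`. -/
def RewritingStep {p q : List P.base.Gen1} (f g : P.base.LCell K p q) : Prop :=
  ∃ (α : P.Gen3) (C : P.base.MonoContext (P.src1 α) (P.tgt1 α) p q) (c : K)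
    (h : P.base.LCell K p q), c ≠ 0 ∧ C.fill (P.src2 α) ∉ h.support ∧
      f = c • LCell.of K (C.fill (P.src2 α)) + h ∧ g = c • C.fillLinear (P.tgt2 α) + h

/-- There is no infinite rewriting sequence. -/
def Terminating : Prop :=
  ∀ p q : List P.base.Gen1, ¬ ∃ f : ℕ → P.base.LCell K p q,
    ∀ n, P.RewritingStep (f n) (f (n + 1))

/-- There is a (finite) rewriting sequence from `f` to `g`. -/
def RewritesTo {p q : List P.base.Gen1} (f g : P.base.LCell K p q) : Prop :=
  Relation.ReflTransGen P.RewritingStep f g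

/-- Every branching can be completed. -/
def Confluent : Prop :=
  ∀ (p q : List P.base.Gen1) (f g h : P.base.LCell K p q),
    P.RewritesTo f g → P.RewritesTo f h → ∃ k, P.RewritesTo g k ∧ P.RewritesTo h k

def Convergent : Prop := P.Terminating ∧ P.Confluent

/-- Formal expressions for the 3-cells of the free linear (3,2)-category generated by `P`, with
their 2-source and 2-target: they are built from the generating 3-cells and the identities by the
compositions `⋆₀`, `⋆₁`, `⋆₂` and by linear combinations.  (The 3-cells are classes of such
expressions; only their existence between two given 2-cells is used.  Inverses for `⋆₂` need not
be added since the inverse of `A : f → g` is `1_f - A + 1_g`.) -/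
inductive Cell3 : ∀ {p q : List P.base.Gen1}, P.base.LCell K p q → P.base.LCell K p q →
    Type (max u v w x)
  | gen (α : P.Gen3) : Cell3 (LCell.of K (P.src2 α)) (P.tgt2 α)
  | id {p q : List P.base.Gen1} (f : P.base.LCell K p q) : Cell3 f f
  | comp2 {p q : List P.base.Gen1} {f g h : P.base.LCell K p q} :
      Cell3 f g → Cell3 g h → Cell3 f h
  | comp1 {p q r : List P.base.Gen1} {f f' : P.base.LCell K p q} {g g' : P.base.LCell K q r} :
      Cell3 f f' → Cell3 g g' → Cell3 (LCell.vcomp f g) (LCell.vcomp f' g')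
  | comp0 {p q p' q' : List P.base.Gen1} {f f' : P.base.LCell K p q}
      {g g' : P.base.LCell K p' q'} :
      Cell3 f f' → Cell3 g g' → Cell3 (LCell.hcomp f g) (LCell.hcomp f' g')
  | add {p q : List P.base.Gen1} {f f' g g' : P.base.LCell K p q} :
      Cell3 f f' → Cell3 g g' → Cell3 (f + g) (f' + g')
  | smul {p q : List P.base.Gen1} (c : K) {f f' : P.base.LCell K p q} :
      Cell3 f f' → Cell3 (c • f) (c • f')

/-- The inverse `1_f - A + 1_g` of a 3-cell `A : f → g`. -/
noncomputable def Cell3.inv {p q : List P.base.Gen1} {f g : P.base.LCell K p q} (A : P.Cell3 f g) :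
    P.Cell3 g f := by
  have B : P.Cell3 (f + (-1 : K) • f + g) (f + (-1 : K) • g + g) :=
    ((Cell3.id f).add (A.smul (-1))).add (Cell3.id g)
  have h₁ : f + (-1 : K) • f + g = g := by simp
  have h₂ : f + (-1 : K) • g + g = f := by simp
  rw [h₁, h₂] at B
  exact B

/-- The congruence generated by `P`: two 2-cells are congruent if there is a 3-cell between them
in the free linear (3,2)-category generated by `P`. -/
def congruence : (P.base.freeLinear K).Congruence where
  rel {_ _ p q} f g := Nonempty (P.Cell3 (p := p) (q := q) f g)
  refl f := ⟨Cell3.id f⟩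
  symm := fun ⟨A⟩ => ⟨A.inv⟩
  trans := fun ⟨A⟩ ⟨B⟩ => ⟨A.comp2 B⟩
  add := fun ⟨A⟩ ⟨B⟩ => ⟨A.add B⟩
  smul c _ _ := fun ⟨A⟩ => ⟨A.smul c⟩
  vcomp := fun ⟨A⟩ ⟨B⟩ => ⟨A.comp1 B⟩
  hcomp := fun ⟨A⟩ ⟨B⟩ => ⟨A.comp0 B⟩

/-- The linear (2,2)-category `C` is presented by `P`: it is isomorphic to the quotient of the free
linear (2,2)-category by the congruence generated by `P`. -/
def Presents (C : LinearTwoCat K) : Prop :=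
  Nonempty (LinearTwoCat.Iso P.congruence.quotient C)

end LinearPolygraph

/-! ## The simply-laced KLR polygraph and the linear (2,2)-category presented by it -/

namespace KLR

open TwoPolygraph

variable {I : Type u}

open Classical in
/-- The bilinear form `i · j` on vertices of the simply-laced graph `Γ`. -/
noncomputable def pairing (Γ : SimpleGraph I) (i j : I) : ℤ :=
  if i = j then 2 else if Γ.Adj i j then -1 else 0

/-- The generating 2-cells: for vertices `i`, `j`, the crossing `i j → j i` and the dot `i → i`. -/
inductive Gen2 (I : Type u) : Type u
  | cross (i j : I) : Gen2 I
  | dot (i : I) : Gen2 I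

/-- One 0-cell, the vertices as generating 1-cells, crossings and dots as generating 2-cells. -/
abbrev base (I : Type u) : TwoPolygraph.{u, u} where
  Gen1 := I
  Gen2 := Gen2 I
  src
    | .cross i j => [i, j]
    | .dot i => [i]
  tgt
    | .cross i j => [j, i]
    | .dot i => [i]

/-- The identity of a word. -/
abbrev idm (p : List I) : (base I).Mono p p := Mono.id (S := base I) p

/-- The crossing. -/
abbrev cross (i j : I) : (base I).Mono [i, j] [j, i] := Mono.gen (S := base I) (Gen2.cross i j)

/-- The dot. -/
abbrev dot (i : I) : (base I).Mono [i] [i] := Mono.gen (S := base I) (Gen2.dot i)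

/-- Dot on the left strand of `i j`. -/
def dotLeft (i j : I) : (base I).Mono [i, j] [i, j] := Mono.hcomp (dot i) (idm [j])

/-- Dot on the right strand of `i j`. -/
def dotRight (i j : I) : (base I).Mono [i, j] [i, j] := Mono.hcomp (idm [i]) (dot j)

/-- Crossing of `i`, `j` with a dot at the upper left. -/
def crossUL (i j : I) : (base I).Mono [i, j] [j, i] := (cross i j).vcomp (dotLeft j i)

/-- Crossing of `i`, `j` with a dot at the upper right. -/
def crossUR (i j : I) : (base I).Mono [i, j] [j, i] := (cross i j).vcomp (dotRight j i)

/-- Crossing of `i`, `j` with a dot at the lower left. -/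
def crossDL (i j : I) : (base I).Mono [i, j] [j, i] := (dotLeft i j).vcomp (cross i j)

/-- Crossing of `i`, `j` with a dot at the lower right. -/
def crossDR (i j : I) : (base I).Mono [i, j] [j, i] := (dotRight i j).vcomp (cross i j)

/-- The double crossing. -/
def doubleCross (i j : I) : (base I).Mono [i, j] [i, j] := (cross i j).vcomp (cross j i)

/-- The braid `i j k → k j i` whose first and third crossings are on the left:
`i j k → j i k → j k i → k j i`. -/
def braidLeft (i j k : I) : (base I).Mono [i, j, k] [k, j, i] :=
  (Mono.vcomp (S := base I) (p := [i, j, k]) (q := [j, i, k]) (r := [j, k, i])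
    (Mono.hcomp (cross i j) (idm [k])) (Mono.hcomp (idm [j]) (cross i k))).vcomp
    (Mono.hcomp (cross j k) (idm [i]))

/-- The braid `i j k → k j i` whose first and third crossings are on the right:
`i j k → i k j → k i j → k j i`. -/
def braidRight (i j k : I) : (base I).Mono [i, j, k] [k, j, i] :=
  (Mono.vcomp (S := base I) (p := [i, j, k]) (q := [i, k, j]) (r := [k, i, j])
    (Mono.hcomp (idm [i]) (cross j k)) (Mono.hcomp (cross i k) (idm [j]))).vcomp
    (Mono.hcomp (idm [k]) (cross i j))

/-- The simply-laced KLR relations, between 2-cells of the free linear (2,2)-category. -/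
inductive Relation (K : Type x) [Field K] (Γ : SimpleGraph I) :
    ∀ {p q : List I}, (base I).LCell K p q → (base I).LCell K p q → Prop
  | double_self (i : I) : Relation K Γ (LCell.of K (doubleCross i i)) 0
  | double_orthogonal (i j : I) : pairing Γ i j = 0 →
      Relation K Γ (LCell.of K (doubleCross i j)) (LCell.of K (idm [i, j]))
  | double_adjacent (i j : I) : pairing Γ i j = -1 →
      Relation K Γ (LCell.of K (doubleCross i j))
        (LCell.of K (dotLeft i j) + LCell.of K (dotRight i j))
  | dot_left (i j : I) : i ≠ j →
      Relation K Γ (LCell.of K (crossUL i j)) (LCell.of K (crossDR i j))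
  | dot_right (i j : I) : i ≠ j →
      Relation K Γ (LCell.of K (crossUR i j)) (LCell.of K (crossDL i j))
  | dot_left_self (i : I) :
      Relation K Γ (LCell.of K (crossUL i i)) (LCell.of K (crossDR i i) + LCell.of K (idm [i, i]))
  | dot_right_self (i : I) :
      Relation K Γ (LCell.of K (crossUR i i)) (LCell.of K (crossDL i i) - LCell.of K (idm [i, i]))
  | braid (i j k : I) : ¬ (i = k ∧ pairing Γ i j = -1) →
      Relation K Γ (LCell.of K (braidLeft i j k)) (LCell.of K (braidRight i j k))
  | braid_adjacent (i j : I) : pairing Γ i j = -1 →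
      Relation K Γ (LCell.of K (braidLeft i j i) - LCell.of K (braidRight i j i))
        (LCell.of K (idm [i, j, i]))

/-- The linear (2,2)-category `C^KLR`: one 0-cell, the words of vertices as 1-cells, and as
2-cells the linear combinations of the diagrams formed by vertical and horizontal compositions of
crossings and dots, subject to the simply-laced KLR relations. -/
noncomputable def category (K : Type x) [Field K] (Γ : SimpleGraph I) :
    LinearTwoCat.{0, u, max u x, x} K :=
  (LinearTwoCat.Congruence.generate (C := (base I).freeLinear K)
    (fun {_ _ p q} f g => Relation K Γ (p := p) (q := q) f g)).quotient

/-- The generating 3-cells of the polygraph `KLR`. -/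
inductive Gen3 (Γ : SimpleGraph I) : Type u
  | alphaL (i j : I) : i ≠ j → Gen3 Γ
  | alphaR (i j : I) : i ≠ j → Gen3 Γ
  | alphaLSelf (i : I) : Gen3 Γ
  | alphaRSelf (i : I) : Gen3 Γ
  | betaSelf (i : I) : Gen3 Γ
  | betaOrthogonal (i j : I) : pairing Γ i j = 0 → Gen3 Γ
  | betaAdjacent (i j : I) : pairing Γ i j = -1 → Gen3 Γ
  | gamma (i j k : I) : ¬ (i = k ∧ pairing Γ i j = -1) → Gen3 Γ
  | gammaAdjacent (i j : I) : pairing Γ i j = -1 → Gen3 Γ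

/-- The linear (3,2)-polygraph `KLR`. -/
noncomputable def polygraph (K : Type x) [Field K] (Γ : SimpleGraph I) :
    LinearPolygraph.{u, u, u, x} K where
  base := base I
  Gen3 := Gen3 Γ
  src1
    | .alphaL i j _ => [i, j]
    | .alphaR i j _ => [i, j]
    | .alphaLSelf i => [i, i]
    | .alphaRSelf i => [i, i]
    | .betaSelf i => [i, i]
    | .betaOrthogonal i j _ => [i, j]
    | .betaAdjacent i j _ => [i, j]
    | .gamma i j k _ => [i, j, k]
    | .gammaAdjacent i j _ => [i, j, i]
  tgt1
    | .alphaL i j _ => [j, i]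
    | .alphaR i j _ => [j, i]
    | .alphaLSelf i => [i, i]
    | .alphaRSelf i => [i, i]
    | .betaSelf i => [i, i]
    | .betaOrthogonal i j _ => [i, j]
    | .betaAdjacent i j _ => [i, j]
    | .gamma i j k _ => [k, j, i]
    | .gammaAdjacent i j _ => [i, j, i]
  src2
    | .alphaL i j _ => crossUL i j
    | .alphaR i j _ => crossUR i j
    | .alphaLSelf i => crossUL i i
    | .alphaRSelf i => crossUR i i
    | .betaSelf i => doubleCross i i
    | .betaOrthogonal i j _ => doubleCross i j
    | .betaAdjacent i j _ => doubleCross i j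
    | .gamma i j k _ => braidLeft i j k
    | .gammaAdjacent i j _ => braidLeft i j i
  tgt2
    | .alphaL i j _ => LCell.of K (crossDR i j)
    | .alphaR i j _ => LCell.of K (crossDL i j)
    | .alphaLSelf i => LCell.of K (crossDR i i) + LCell.of K (idm [i, i])
    | .alphaRSelf i => LCell.of K (crossDL i i) - LCell.of K (idm [i, i])
    | .betaSelf _ => 0
    | .betaOrthogonal i j _ => LCell.of K (idm [i, j])
    | .betaAdjacent i j _ => LCell.of K (dotLeft i j) + LCell.of K (dotRight i j)
    | .gamma i j k _ => LCell.of K (braidRight i j k)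
    | .gammaAdjacent i j _ => LCell.of K (braidRight i j i) + LCell.of K (idm [i, j, i])

end KLR

/-! Termination comes from a rank on monomials, confluence from a representation that separates
normal forms; no critical branching is computed.

A monomial is ranked lexicographically by three numbers: its number of crossings; the sum of N - k
over its crossings, where k is the position of the crossing and N the number of strands, which falls
when a braid is pushed to the right; the sum of the heights of its dots, where each crossing raises
the strands through it, which falls when a dot slides below a crossing. Correction terms have fewer
crossings. The decrease holds in every context (`Rule.rank_lt`), so each step lowers the multiset of
ranks of the support in the Dershowitz–Manna order.

A monomial that contains no source of a rule is standard: all dots are at the bottom, and the first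
strand is carried to its final place by one ladder of crossings above a standard diagram on the
other strands (`reducible_or_isStandard`). It is determined by the places of its strands, its code,
and the exponents of its dots.

On the rational functions in x_0, x_1, ..., dots act by multiplication, crossings of equal labels by
divided differences, and other crossings by transpositions, with the factor x_k + x_{k+1} if the
edge is oriented from i to j. All rules hold for these operators (`Rule.rep_eq`), so rewriting
preserves the operator of a 2-cell. The operators of the codes are independent over the field acting
on the right (`eq_zero_of_codeOp_sum`): the maps T ↦ T x_n - x_j T kill all ladders of the first
strand but the longest ones, and the induction continues with the other strands. Dots give distinct
monomials in the coefficients, so a combination of irreducible monomials with zero operator is zero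
(`eq_zero_of_cellOp`). Two normal forms of one 2-cell therefore coincide.

For the presentation, the rules and the defining relations differ only by moving one term across the
adjacent braid relation.

The work takes place in a monoid of positioned generators without sources and targets. Nothing is
lost: between fixed 1-cells a monomial is determined by its diagram (`diag_injective`), and a source
of a rule found in the diagram occurs in the monomial (`exists_fill`). -/

namespace KLR

open TwoPolygraph

variable {I : Type u}

/-! ### Diagrams as words of positioned generators -/

/-- The number of strands through a generating 2-cell. -/
def Gen2.width : Gen2 I → ℕ
  | .cross _ _ => 2
  | .dot _ => 1

theorem length_src (g : Gen2 I) : ((base I).src g).length = g.width := by cases g <;> rfl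

theorem length_tgt (g : Gen2 I) : ((base I).tgt g).length = g.width := by cases g <;> rfl

/-- Generators at disjoint positions commute. -/
inductive Far : FreeMonoid (ℕ × Gen2 I) → FreeMonoid (ℕ × Gen2 I) → Prop
  | swap (k l : ℕ) (g h : Gen2 I) : k + g.width ≤ l →
      Far (FreeMonoid.of (k, g) * FreeMonoid.of (l, h))
        (FreeMonoid.of (l, h) * FreeMonoid.of (k, g))

variable (I) in
/-- The monoid of diagrams: words of generators placed at positions, read from bottom to top, up
to the commutation of generators at disjoint positions. -/
abbrev Diag : Type u := PresentedMonoid (Far (I := I))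

/-- The generator `g` at position `k`. -/
def letter (k : ℕ) (g : Gen2 I) : Diag I := PresentedMonoid.of Far (k, g)

/-- The crossing of the strands at positions `k` and `k + 1`. -/
abbrev crossAt (k : ℕ) (i j : I) : Diag I := letter k (.cross i j)

/-- The dot at position `k`. -/
abbrev dotAt (k : ℕ) (i : I) : Diag I := letter k (.dot i)

theorem commute_letter {k l : ℕ} {g h : Gen2 I} (hkl : k + g.width ≤ l) :
    Commute (letter k g) (letter l h) :=
  (Con.eq _).2 (ConGen.Rel.of _ _ (Far.swap k l g h hkl))

/-- The diagram of a list of positioned generators. -/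
def ofList (x : List (ℕ × Gen2 I)) : Diag I := PresentedMonoid.mk Far (FreeMonoid.ofList x)

@[simp] theorem ofList_nil : ofList ([] : List (ℕ × Gen2 I)) = 1 := rfl

@[simp] theorem ofList_cons (a : ℕ × Gen2 I) (x : List (ℕ × Gen2 I)) :
    ofList (a :: x) = letter a.1 a.2 * ofList x := rfl

@[simp] theorem ofList_append (x y : List (ℕ × Gen2 I)) :
    ofList (x ++ y) = ofList x * ofList y := by
  induction x with
  | nil => simp
  | cons a x ih => simp [ih, mul_assoc]

theorem exists_ofList (y : Diag I) : ∃ x, ofList x = y := by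
  induction y using Con.induction_on with
  | H x => exact ⟨FreeMonoid.toList x, rfl⟩

/-- The list of positioned generators of a word, the first position being `n`. -/
def toList (n : ℕ) : ∀ {p q : List (base I).Gen1}, (base I).Word p q → List (ℕ × Gen2 I)
  | _, _, .nil _ => []
  | _, _, .cons l f => (n + l.left.length, l.gen) :: toList n f

theorem toList_append (n : ℕ) {p q r : List (base I).Gen1} (f : (base I).Word p q) (g : (base I).Word q r) :
    toList n (f.append g) = toList n f ++ toList n g := by
  induction f with
  | nil p => rfl
  | cons l f ih => exact congrArg (_ :: ·) (ih g)

theorem toList_whiskerLeft (n : ℕ) (c : List I) {p q : List (base I).Gen1} (f : (base I).Word p q) :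
    toList n (f.whiskerLeft c) = toList (n + c.length) f := by
  induction f with
  | nil p => rfl
  | cons l f ih =>
    simp only [Word.whiskerLeft, toList, ih, Layer.whiskerLeft, List.length_append, add_assoc]

theorem toList_whiskerRight (n : ℕ) (c : List I) {p q : List (base I).Gen1} (f : (base I).Word p q) :
    toList n (f.whiskerRight c) = toList n f := by
  induction f with
  | nil p => rfl
  | cons l f ih => simp only [Word.whiskerRight, toList, ih, Layer.whiskerRight]

theorem Exchange.ofList_toList (n : ℕ) {p q : List (base I).Gen1} {f f' : (base I).Word p q}
    (h : Word.Exchange f f') : ofList (toList n f) = ofList (toList n f') := by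
  induction h with
  | swap a b c g h h₁ h₂ h₃ h₄ h₅ h₆ h₇ h₈ f =>
    have e₁ := length_src g
    have e₂ := length_tgt g
    dsimp only at e₁ e₂
    simp only [toList, ofList_cons, ← mul_assoc, List.length_append, e₁, e₂]
    rw [(commute_letter (by omega)).eq]
  | cons l _ ih => simp only [toList, ofList_cons, ih]

/-- The diagram of a monomial, the first position being `n`. -/
def diag (n : ℕ) {p q : List (base I).Gen1} (f : (base I).Mono p q) : Diag I :=
  Quot.liftOn f (fun f => ofList (toList n f)) fun _ _ h => Exchange.ofList_toList n h

@[simp] theorem diag_id (n : ℕ) (p : List I) : diag n (Mono.id (S := base I) p) = 1 := rfl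

@[simp] theorem diag_cross (n : ℕ) (i j : I) : diag n (cross i j) = crossAt n i j := rfl

@[simp] theorem diag_dot (n : ℕ) (i : I) : diag n (dot i) = dotAt n i := rfl

@[simp] theorem diag_vcomp (n : ℕ) {p q r : List (base I).Gen1} (f : (base I).Mono p q)
    (g : (base I).Mono q r) : diag n (f.vcomp g) = diag n f * diag n g := by
  obtain ⟨f, rfl⟩ := f.exists_rep
  obtain ⟨g, rfl⟩ := g.exists_rep
  exact (congrArg ofList (toList_append n f g)).trans (ofList_append _ _)

theorem diag_whiskerLeft (n : ℕ) (c : List I) {p q : List (base I).Gen1} (f : (base I).Mono p q) :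
    diag n (f.whiskerLeft c) = diag (n + c.length) f := by
  obtain ⟨f, rfl⟩ := f.exists_rep
  exact congrArg ofList (toList_whiskerLeft n c f)

theorem diag_whiskerRight (n : ℕ) (c : List I) {p q : List (base I).Gen1} (f : (base I).Mono p q) :
    diag n (f.whiskerRight c) = diag n f := by
  obtain ⟨f, rfl⟩ := f.exists_rep
  exact congrArg ofList (toList_whiskerRight n c f)

@[simp] theorem diag_hcomp (n : ℕ) {p q p' q' : List (base I).Gen1} (f : (base I).Mono p q)
    (g : (base I).Mono p' q') : diag n (f.hcomp g) = diag n f * diag (n + q.length) g := by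
  rw [Mono.hcomp, diag_vcomp, diag_whiskerLeft, diag_whiskerRight]

theorem diag_fill (n : ℕ) {r s p q : List (base I).Gen1} (C : (base I).MonoContext r s p q)
    (m : (base I).Mono r s) :
    diag n (C.fill m) = (diag n C.m₁ * diag n C.m₂) * diag (n + C.a'.length) m *
      (diag (n + C.a'.length + s.length) C.m₃ * diag n C.m₄) := by
  simp only [MonoContext.fill, diag_vcomp, diag_hcomp, mul_assoc, List.length_append, add_assoc]

/-! ### Monomials are determined by their diagrams -/

/-- Once the source is known, the position fixes the left part of a layer, the generator fixes the
middle, and what remains is the right part. -/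
theorem toList_injective (n : ℕ) {p q : List (base I).Gen1} {f g : (base I).Word p q}
    (h : toList n f = toList n g) : f = g := by
  induction f with
  | nil p =>
    cases g with
    | nil _ => rfl
    | cons l g => cases h
  | cons l f ih =>
    cases g with
    | nil _ => cases h
    | cons l' g =>
      obtain ⟨a, g₁, b, hs, ht⟩ := l
      obtain ⟨a', g₂, b', hs', ht'⟩ := l'
      simp only [toList, List.cons.injEq, Prod.mk.injEq] at h
      obtain ⟨⟨h₁, rfl⟩, h₂⟩ := h
      have h₃ := hs.symm.trans hs'
      rw [List.append_assoc, List.append_assoc] at h₃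
      obtain ⟨rfl, h₄⟩ := List.append_inj h₃ (by omega)
      obtain rfl := List.append_cancel_left h₄
      subst ht ht'
      rw [ih h₂]

theorem exists_append_of_toList (n : ℕ) {p q : List (base I).Gen1} (f : (base I).Word p q)
    (x y : List (ℕ × Gen2 I)) (h : toList n f = x ++ y) :
    ∃ (r : List (base I).Gen1) (g : (base I).Word p r) (g' : (base I).Word r q),
      toList n g = x ∧ toList n g' = y ∧ f = g.append g' := by
  induction x generalizing p with
  | nil => exact ⟨p, .nil p, f, rfl, h, rfl⟩
  | cons a x ih =>
    cases f with
    | nil _ => cases h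
    | cons l f =>
      simp only [toList, List.cons_append, List.cons.injEq] at h
      obtain ⟨r, g, g', h₁, h₂, rfl⟩ := ih f h.2
      exact ⟨r, .cons l g, g', by simp only [toList, h₁, h.1], h₂, rfl⟩

theorem exists_middle_of_append_eq {A : Type*} {a s c a' t : List A}
    (h : a ++ s ++ c = a' ++ t) (hl : a.length + s.length ≤ a'.length) :
    ∃ b, a' = a ++ s ++ b ∧ c = b ++ t := by
  obtain ⟨b, hb, hb'⟩ | ⟨b, hb, hb'⟩ := List.append_eq_append_iff.1 h
  · exact ⟨b, hb, hb'⟩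
  · have h₁ := congrArg List.length hb
    simp only [List.length_append] at h₁
    obtain rfl : b = [] := List.eq_nil_of_length_eq_zero (by omega)
    exact ⟨[], by simpa using hb.symm, by simpa using hb'.symm⟩

/-- Every word with the list `x` is equal, as a monomial, to a word with the list `y`. -/
def Lifts (x y : List (ℕ × Gen2 I)) : Prop :=
  ∀ (p q : List (base I).Gen1) (f : (base I).Word p q), toList 0 f = x →
    ∃ f' : (base I).Word p q, toList 0 f' = y ∧ Mono.mk f = Mono.mk f'

theorem Lifts.mul {x y x' y' : List (ℕ × Gen2 I)} (h : Lifts x y) (h' : Lifts x' y') :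
    Lifts (x ++ x') (y ++ y') := by
  intro p q f hf
  obtain ⟨r, g, g', rfl, rfl, rfl⟩ := exists_append_of_toList 0 f x x' hf
  obtain ⟨k, hk, e⟩ := h _ _ g rfl
  obtain ⟨k', hk', e'⟩ := h' _ _ g' rfl
  refine ⟨k.append k', by rw [toList_append, hk, hk'], ?_⟩
  change (Mono.mk g).vcomp (Mono.mk g') = (Mono.mk k).vcomp (Mono.mk k')
  rw [e, e']

/-- A commutation of diagrams ignores 1-cells. Disjointness of the positions provides the word `b`
between the two generators, which turns it into an exchange on the given word. -/
theorem lifts_swap {k l : ℕ} {g h : Gen2 I} (hkl : k + g.width ≤ l) :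
    Lifts [(k, g), (l, h)] [(l, h), (k, g)] := by
  intro p q f hf
  obtain _ | ⟨⟨a, g, c, h₁, h₂⟩, _ | ⟨⟨a', h, d, h₃, h₄⟩, _ | ⟨l, f⟩⟩⟩ := f
  · cases hf
  · cases hf
  · simp only [toList, List.cons.injEq, Prod.mk.injEq, and_true, zero_add] at hf
    obtain ⟨⟨rfl, rfl⟩, rfl, rfl⟩ := hf
    have h₅ := h₂.symm.trans h₃
    rw [List.append_assoc a'] at h₅
    obtain ⟨b, rfl, hc⟩ := exists_middle_of_append_eq h₅ (by rw [length_tgt]; exact hkl)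
    rw [← List.append_assoc] at hc
    subst hc
    have key := Word.Exchange.swap (S := base I) a b d g h (h₁.trans (by simp)) (h₂.trans (by simp))
      h₃ h₄ (m' := a ++ (base I).src g ++ (b ++ (base I).tgt h ++ d)) (h₁.trans (by simp))
      (by simp) rfl (h₄.trans (by simp)) (.nil _)
    refine ⟨_, ?_, Quot.sound key⟩
    have e₁ := length_src g
    have e₂ := length_tgt g
    dsimp only at e₁ e₂
    simp only [toList, List.length_append, e₁, e₂, zero_add]
  · cases hf

theorem lifts_swap_symm {k l : ℕ} {g h : Gen2 I} (hkl : k + g.width ≤ l) :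
    Lifts [(l, h), (k, g)] [(k, g), (l, h)] := by
  intro p q f hf
  obtain _ | ⟨⟨a', h, d, h₁, h₂⟩, _ | ⟨⟨a, g, c, h₃, h₄⟩, _ | ⟨l, f⟩⟩⟩ := f
  · cases hf
  · cases hf
  · simp only [toList, List.cons.injEq, Prod.mk.injEq, and_true, zero_add] at hf
    obtain ⟨⟨rfl, rfl⟩, rfl, rfl⟩ := hf
    have h₅ := h₃.symm.trans h₂
    rw [List.append_assoc a'] at h₅
    obtain ⟨b, rfl, hc⟩ := exists_middle_of_append_eq h₅ (by rw [length_src]; exact hkl)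
    rw [← List.append_assoc] at hc
    subst hc
    have key := Word.Exchange.swap (S := base I) a b d g h (h₁.trans (by simp))
      (m := a ++ (base I).tgt g ++ (b ++ (base I).src h ++ d)) rfl
      (by simp) (h₄.trans (by simp)) h₁ h₂ (h₃.trans (by simp)) (h₄.trans (by simp)) (.nil _)
    refine ⟨_, ?_, (Quot.sound key).symm⟩
    have e₁ := length_src g
    have e₂ := length_tgt g
    dsimp only at e₁ e₂
    simp only [toList, List.length_append, e₁, e₂, zero_add]
  · cases hf

/-- Induction on the generated congruence; both directions are carried together for the sake of the
symmetric case. -/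
theorem lifts_of_rel {x y : FreeMonoid (ℕ × Gen2 I)} (h : ConGen.Rel Far x y) :
    Lifts (FreeMonoid.toList x) (FreeMonoid.toList y) ∧
      Lifts (FreeMonoid.toList y) (FreeMonoid.toList x) := by
  induction h with
  | of x y h =>
    cases h with
    | swap k l g h hkl => exact ⟨lifts_swap hkl, lifts_swap_symm hkl⟩
  | refl x => exact ⟨fun _ _ f h => ⟨f, h, rfl⟩, fun _ _ f h => ⟨f, h, rfl⟩⟩
  | symm _ ih => exact ih.symm
  | trans _ _ ih ih' =>
    have key {x y z : List (ℕ × Gen2 I)} (h : Lifts x y) (h' : Lifts y z) : Lifts x z := by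
      intro p q f hf
      obtain ⟨g, hg, e⟩ := h p q f hf
      obtain ⟨k, hk, e'⟩ := h' p q g hg
      exact ⟨k, hk, e.trans e'⟩
    exact ⟨key ih.1 ih'.1, key ih'.2 ih.2⟩
  | mul _ _ ih ih' => exact ⟨ih.1.mul ih'.1, ih.2.mul ih'.2⟩

/-- This brings factorizations of diagrams back to monomials: any list representing the diagram is
the list of a well-typed word. -/
theorem exists_word_of_diag {p q : List (base I).Gen1} (f : (base I).Mono p q) (x : List (ℕ × Gen2 I))
    (h : diag 0 f = ofList x) : ∃ g : (base I).Word p q, toList 0 g = x ∧ f = Mono.mk g := by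
  obtain ⟨f, rfl⟩ := f.exists_rep
  exact (lifts_of_rel ((Con.eq _).1 h)).1 p q f rfl

theorem diag_injective {p q : List (base I).Gen1} {f g : (base I).Mono p q} (h : diag 0 f = diag 0 g) :
    f = g := by
  obtain ⟨g, rfl⟩ := g.exists_rep
  obtain ⟨g', h', rfl⟩ := exists_word_of_diag f (toList 0 g) h
  rw [toList_injective 0 h']

end KLR

namespace KLR

open TwoPolygraph

variable {I : Type u}

/-! ### Reducible diagrams -/

/-- The sources of the rewriting rules, at position `k`. -/
inductive Redex : Diag I → Prop
  | dotLeft (k : ℕ) (i j : I) : Redex (crossAt k i j * dotAt k j)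
  | dotRight (k : ℕ) (i j : I) : Redex (crossAt k i j * dotAt (k + 1) i)
  | double (k : ℕ) (i j : I) : Redex (crossAt k i j * crossAt k j i)
  | braid (k : ℕ) (i j l : I) : Redex (crossAt k i j * crossAt (k + 1) i l * crossAt k j l)

/-- A diagram that contains the source of a rewriting rule. -/
def Reducible (y : Diag I) : Prop := ∃ u s v, Redex s ∧ y = u * s * v

theorem Redex.reducible {s : Diag I} (h : Redex s) : Reducible s := ⟨1, s, 1, h, by simp⟩

theorem Reducible.mul_left {y : Diag I} (h : Reducible y) (z : Diag I) : Reducible (z * y) := by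
  obtain ⟨u, s, v, hs, rfl⟩ := h
  exact ⟨z * u, s, v, hs, by simp only [mul_assoc]⟩

theorem Reducible.mul_right {y : Diag I} (h : Reducible y) (z : Diag I) : Reducible (y * z) := by
  obtain ⟨u, s, v, hs, rfl⟩ := h
  exact ⟨u, s, v * z, hs, by simp only [mul_assoc]⟩

/-- Source and list determine the target. This provides the type of the top of the hole in
`exists_fill`. -/
theorem target_eq_of_toList (n : ℕ) {p q q' : List (base I).Gen1} {f : (base I).Word p q}
    {g : (base I).Word p q'} (h : toList n f = toList n g) : q = q' := by
  induction f with
  | nil p =>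
    cases g with
    | nil _ => rfl
    | cons l g => cases h
  | cons l f ih =>
    cases g with
    | nil _ => cases h
    | cons l' g =>
      obtain ⟨a, g₁, b, hs, ht⟩ := l
      obtain ⟨a', g₂, b', hs', ht'⟩ := l'
      simp only [toList, List.cons.injEq, Prod.mk.injEq] at h
      obtain ⟨⟨h₁, rfl⟩, h₂⟩ := h
      have h₃ := hs.symm.trans hs'
      rw [List.append_assoc, List.append_assoc] at h₃
      obtain ⟨rfl, h₄⟩ := List.append_inj h₃ (by omega)
      obtain rfl := List.append_cancel_left h₄
      subst ht ht'
      exact ih h₂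

/-- If the list `x` of the diagram of `s` determines the strands on which it acts, then a monomial
whose diagram contains `x` is obtained from `s` by filling a context. -/
theorem exists_fill {r t : List (base I).Gen1} (s : (base I).Mono r t) (k : ℕ)
    (x : List (ℕ × Gen2 I)) (hx : diag k s = ofList x)
    (hr : ∀ (r₀ r₁ : List (base I).Gen1) (f : (base I).Word r₀ r₁), toList 0 f = x →
      ∃ a b, a.length = k ∧ r₀ = a ++ r ++ b)
    {p q : List (base I).Gen1} (m : (base I).Mono p q) (u v : Diag I)
    (h : diag 0 m = u * diag k s * v) :
    ∃ C : (base I).MonoContext r t p q, m = C.fill s := by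
  obtain ⟨y, rfl⟩ := exists_ofList u
  obtain ⟨z, rfl⟩ := exists_ofList v
  have h' : diag 0 m = ofList (y ++ x ++ z) := by rw [h, hx, ofList_append, ofList_append]
  obtain ⟨f, hf, rfl⟩ := exists_word_of_diag m _ h'
  obtain ⟨r₁, f', f₃, h₁, rfl, rfl⟩ := exists_append_of_toList 0 f _ _ hf
  obtain ⟨r₀, f₁, f₂, rfl, h₂, rfl⟩ := exists_append_of_toList 0 f' _ _ h₁
  obtain ⟨a, b, rfl, rfl⟩ := hr _ _ f₂ h₂
  -- A word for `s` between the identities of `a` and `b` with the same list and source as `f₂`,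
  -- hence with the same target.
  have h₃ : diag 0 (((Mono.id a).hcomp s).hcomp (Mono.id b)) = ofList x := by
    simp only [diag_hcomp, diag_id, hx, one_mul, mul_one, zero_add]
  obtain ⟨g, hg, -⟩ := exists_word_of_diag _ _ h₃
  obtain rfl := target_eq_of_toList 0 (h₂.trans hg.symm)
  refine ⟨⟨Mono.mk f₁, Mono.id a, Mono.id b, Mono.mk f₃⟩, diag_injective ?_⟩
  rw [diag_fill, h]
  simp only [diag_id, mul_one, one_mul, zero_add]
  rfl

/-! ### Locating the source of a rule in a monomial -/

theorem strands_of_cross {k : ℕ} {i j : I} {x : List (ℕ × Gen2 I)} {r₀ r₁ : List (base I).Gen1}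
    (f : (base I).Word r₀ r₁) (h : toList 0 f = (k, .cross i j) :: x) :
    ∃ a b, a.length = k ∧ r₀ = a ++ [i, j] ++ b := by
  cases f with
  | nil _ => cases h
  | cons l f =>
    obtain ⟨a, g, b, hs, ht⟩ := l
    simp only [toList, List.cons.injEq, Prod.mk.injEq, zero_add] at h
    obtain ⟨⟨h₁, rfl⟩, h₂⟩ := h
    exact ⟨a, b, h₁, hs⟩

theorem strands_of_braid {k : ℕ} {i j l : I} {x : List (ℕ × Gen2 I)}
    {r₀ r₁ : List (base I).Gen1} (f : (base I).Word r₀ r₁)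
    (h : toList 0 f = (k, .cross i j) :: (k + 1, .cross i l) :: x) :
    ∃ a b, a.length = k ∧ r₀ = a ++ [i, j, l] ++ b := by
  cases f with
  | nil _ => cases h
  | cons l f =>
    obtain ⟨a, g, b, hs, ht⟩ := l
    simp only [toList, List.cons.injEq, Prod.mk.injEq, zero_add] at h
    obtain ⟨⟨h₁, rfl⟩, h₂⟩ := h
    obtain ⟨a', b', h₃, h₄⟩ := strands_of_cross f h₂
    -- The 1-cell between the first two crossings, seen from below and from above; its third strand
    -- is thereby `l`.
    have h₅ : (a ++ [j]) ++ (i :: b) = a' ++ (i :: l :: b') := by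
      simpa using ht.symm.trans h₄
    obtain ⟨rfl, h₆⟩ := List.append_inj h₅ (by simp; omega)
    simp only [List.cons.injEq, true_and] at h₆
    subst h₆
    exact ⟨a, b', h₁, by simpa using hs⟩

theorem pairing_trichotomy (Γ : SimpleGraph I) {i j : I} (h : i ≠ j) :
    pairing Γ i j = 0 ∨ pairing Γ i j = -1 := by
  simp only [pairing, h, if_false]
  split_ifs <;> simp

/-- `Redex` carries no condition on the labels: for each shape, the cases of equal, orthogonal and
adjacent labels together provide a rule in every case. -/
theorem exists_fill_of_reducible (K : Type x) [Field K] (Γ : SimpleGraph I)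
    {p q : List (base I).Gen1} (m : (base I).Mono p q) (h : Reducible (diag 0 m)) :
    ∃ (α : Gen3 Γ) (C : (base I).MonoContext ((polygraph K Γ).src1 α) ((polygraph K Γ).tgt1 α) p q),
      m = C.fill ((polygraph K Γ).src2 α) := by
  obtain ⟨u, s, v, hs, h⟩ := h
  cases hs with
  | dotLeft k i j =>
    have key := exists_fill (crossUL i j) k [(k, .cross i j), (k, .dot j)]
      (by simp [crossUL, KLR.dotLeft]) (fun _ _ f hf => strands_of_cross f hf) m u v
      (by simpa [crossUL, KLR.dotLeft] using h)
    by_cases hij : i = j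
    · subst hij
      exact ⟨.alphaLSelf i, key⟩
    · exact ⟨.alphaL i j hij, key⟩
  | dotRight k i j =>
    have key := exists_fill (crossUR i j) k [(k, .cross i j), (k + 1, .dot i)]
      (by simp [crossUR, KLR.dotRight]) (fun _ _ f hf => strands_of_cross f hf) m u v
      (by simpa [crossUR, KLR.dotRight] using h)
    by_cases hij : i = j
    · subst hij
      exact ⟨.alphaRSelf i, key⟩
    · exact ⟨.alphaR i j hij, key⟩
  | double k i j =>
    have key := exists_fill (doubleCross i j) k [(k, .cross i j), (k, .cross j i)]
      (by simp [doubleCross]) (fun _ _ f hf => strands_of_cross f hf) m u v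
      (by simpa [doubleCross] using h)
    by_cases hij : i = j
    · subst hij
      exact ⟨.betaSelf i, key⟩
    · obtain hp | hp := pairing_trichotomy Γ hij
      · exact ⟨.betaOrthogonal i j hp, key⟩
      · exact ⟨.betaAdjacent i j hp, key⟩
  | braid k i j l =>
    have key := exists_fill (braidLeft i j l) k
      [(k, .cross i j), (k + 1, .cross i l), (k, .cross j l)]
      (by simp [braidLeft, mul_assoc]) (fun _ _ f hf => strands_of_braid f hf) m u v
      (by simpa [braidLeft] using h)
    by_cases hp : i = l ∧ pairing Γ i j = -1
    · obtain ⟨rfl, hp⟩ := hp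
      exact ⟨.gammaAdjacent i j hp, key⟩
    · exact ⟨.gamma i j l hp, key⟩

/-! ### Standard diagrams -/

/-- The strand `i` starting at position `n` and crossing the strands of `q` from left to right. -/
def ladder (n : ℕ) (i : I) : List I → Diag I
  | [] => 1
  | j :: q => crossAt n i j * ladder (n + 1) i q

theorem ladder_append (n : ℕ) (i : I) (q q' : List I) :
    ladder n i (q ++ q') = ladder n i q * ladder (n + q.length) i q' := by
  induction q generalizing n with
  | nil => simp [ladder]
  | cons j q ih =>
    simp only [List.cons_append, ladder, ih, mul_assoc, List.length_cons]
    rw [show n + 1 + q.length = n + (q.length + 1) by omega]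

theorem commute_ladder {n l : ℕ} (i : I) (q : List I) (g : Gen2 I) (h : n + q.length + 1 ≤ l) :
    Commute (ladder n i q) (letter l g) := by
  induction q generalizing n with
  | nil => exact Commute.one_left _
  | cons j q ih =>
    simp only [List.length_cons] at h
    exact (commute_letter (by simp only [Gen2.width]; omega)).mul_left (ih (by omega))

theorem commute_letter_ladder {n k : ℕ} (i : I) (q : List I) (g : Gen2 I) (h : k + g.width ≤ n) :
    Commute (letter k g) (ladder n i q) := by
  induction q generalizing n with
  | nil => exact Commute.one_right _
  | cons j q ih => exact (commute_letter h).mul_right (ih (by omega))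

/-- The standard diagrams from `p` to `q`, the first strand being at position `n`: dots on the
first strand, followed by a standard diagram on the other strands, followed by a ladder that
carries the first strand to its final position. -/
inductive IsStandard : ℕ → List I → List I → Diag I → Prop
  | nil (n : ℕ) : IsStandard n [] [] 1
  | cons (n : ℕ) (i : I) (a : ℕ) {p : List I} (q₁ q₂ : List I) {m : Diag I} :
      IsStandard (n + 1) p (q₁ ++ q₂) m →
      IsStandard n (i :: p) (q₁ ++ i :: q₂) (dotAt n i ^ a * m * ladder n i q₁)

theorem IsStandard.commute {n : ℕ} {p q : List I} {m : Diag I} (h : IsStandard n p q m) {k : ℕ}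
    {g : Gen2 I} (hk : k + g.width ≤ n) : Commute (letter k g) m := by
  induction h with
  | nil n => exact Commute.one_right _
  | cons n i a q₁ q₂ _ ih =>
    exact (((commute_letter hk).pow_right a).mul_right (ih (by omega))).mul_right
      (commute_letter_ladder _ _ _ hk)

theorem IsStandard.id (n : ℕ) (p : List I) : IsStandard n p p 1 := by
  induction p generalizing n with
  | nil => exact .nil n
  | cons i p ih => simpa [ladder] using IsStandard.cons n i 0 [] p (ih (n + 1))

/-! ### Generators on top of a ladder -/

/-- The crossings of the ladder after the one with `j` lie to the right of the dot, so the dot comes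
down onto the upper left of that crossing. -/
theorem reducible_ladder_dot (n : ℕ) (i j : I) (a q : List I) :
    Reducible (ladder n i (a ++ j :: q) * dotAt (n + a.length) j) := by
  rw [ladder_append, ladder, mul_assoc, mul_assoc,
    (commute_letter_ladder i q (.dot j) (by simp [Gen2.width])).eq.symm, ← mul_assoc (letter _ _)]
  exact ((Redex.dotLeft _ i j).reducible.mul_right _).mul_left _

theorem reducible_ladder_dot_last (n : ℕ) (i j : I) (a : List I) :
    Reducible (ladder n i (a ++ [j]) * dotAt (n + (a ++ [j]).length) i) := by
  rw [ladder_append, ladder, ladder, mul_one, mul_assoc, List.length_append, ← add_assoc]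
  exact (Redex.dotRight _ i j).reducible.mul_left _

/-- The later crossings of the ladder commute with the new one, which then meets the crossings of
`i` with `j` and `l` and completes the left side of a braid relation. -/
theorem reducible_ladder_cross (n : ℕ) (i j l : I) (a q : List I) :
    Reducible (ladder n i (a ++ j :: l :: q) * crossAt (n + a.length) j l) := by
  rw [ladder_append, ladder, ladder, mul_assoc, mul_assoc, mul_assoc,
    (commute_letter_ladder i q (.cross j l) (by simp [Gen2.width])).eq.symm,
    ← mul_assoc (letter _ _) (letter _ _) (ladder _ _ _), ← mul_assoc (letter _ _) (_ * _),
    ← mul_assoc (letter _ _) (letter _ _) (letter _ _)]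
  exact ((Redex.braid _ i j l).reducible.mul_right _).mul_left _

theorem reducible_ladder_cross_last (n : ℕ) (i j : I) (a : List I) :
    Reducible (ladder n i (a ++ [j]) * crossAt (n + a.length) j i) := by
  rw [ladder_append, ladder, ladder, mul_one, mul_assoc]
  exact (Redex.double _ i j).reducible.mul_left _

/-- The letter `i` is beyond the first place of `t`, at its first place, or in `a`. -/
theorem append_cons_eq_append {A : Type*} {q₁ q₂ a t : List A} {i : A}
    (h : q₁ ++ i :: q₂ = a ++ t) :
    (∃ c, c ≠ [] ∧ q₁ = a ++ c ∧ c ++ i :: q₂ = t) ∨ (q₁ = a ∧ i :: q₂ = t) ∨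
      ∃ c, a = q₁ ++ i :: c ∧ q₂ = c ++ t := by
  obtain ⟨c, h₁, h₂⟩ | ⟨c, h₁, h₂⟩ := List.append_eq_append_iff.1 h
  · obtain _ | ⟨j, c⟩ := c
    · exact .inr (.inl ⟨by simpa using h₁.symm, by simpa using h₂⟩)
    · simp only [List.cons_append, List.cons.injEq] at h₂
      obtain ⟨rfl, h₂⟩ := h₂
      exact .inr (.inr ⟨c, h₁, h₂⟩)
  · obtain _ | ⟨j, c⟩ := c
    · exact .inr (.inl ⟨by simpa using h₁, by simpa using h₂.symm⟩)
    · exact .inl ⟨j :: c, by simp, h₁, h₂.symm⟩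

/-- A generator on top of a standard diagram gives a reducible or a standard diagram. -/
theorem IsStandard.mul_letter {n : ℕ} {p q : List I} {m : Diag I} (h : IsStandard n p q m)
    (a b : List I) (g : Gen2 I) (hq : q = a ++ (base I).src g ++ b) :
    Reducible (m * letter (n + a.length) g) ∨
      IsStandard n p (a ++ (base I).tgt g ++ b) (m * letter (n + a.length) g) := by
  induction h generalizing a b with
  | nil n => cases g <;> simp at hq
  | @cons n i e p q₁ q₂ m hm ih =>
    -- the generator acts on the right of the first strand
    have right : ∀ a', a = q₁ ++ i :: a' → q₂ = a' ++ (base I).src g ++ b →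
        Reducible (dotAt n i ^ e * m * ladder n i q₁ * letter (n + a.length) g) ∨
        IsStandard n (i :: p) (a ++ (base I).tgt g ++ b)
          (dotAt n i ^ e * m * ladder n i q₁ * letter (n + a.length) g) := by
      rintro a' rfl rfl
      -- The positions of `m` start at `n + 1`, so the strand `i` missing from its target is made up
      -- for by this shift.
      have e₁ : n + (q₁ ++ i :: a').length = n + 1 + (q₁ ++ a').length := by
        simp only [List.length_append, List.length_cons]; omega
      have e₂ : dotAt n i ^ e * m * ladder n i q₁ * letter (n + 1 + (q₁ ++ a').length) g =
          dotAt n i ^ e * (m * letter (n + 1 + (q₁ ++ a').length) g) * ladder n i q₁ := by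
        have hc : Commute (ladder n i q₁) (letter (n + 1 + (q₁ ++ a').length) g) :=
          commute_ladder i q₁ g (by simp only [List.length_append]; omega)
        rw [mul_assoc, hc.eq]
        simp only [mul_assoc]
      rw [e₁, e₂]
      obtain h | h := ih (q₁ ++ a') b (by simp)
      · exact .inl ((h.mul_left _).mul_right _)
      · rw [List.append_assoc, List.append_assoc] at h
        right
        simpa using IsStandard.cons n i e q₁ _ h
    rw [List.append_assoc] at hq
    cases g with
    | dot j =>
      obtain ⟨c, hc, rfl, h⟩ | ⟨rfl, h⟩ | ⟨c, h₁, h₂⟩ := append_cons_eq_append hq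
      · obtain _ | ⟨l, c⟩ := c
        · exact absurd rfl hc
        · simp only [List.cons_append, List.nil_append, List.cons.injEq] at h
          obtain ⟨rfl, -⟩ := h
          left
          rw [mul_assoc]
          exact (reducible_ladder_dot n i l a c).mul_left _
      · simp only [List.cons_append, List.nil_append, List.cons.injEq] at h
        obtain ⟨rfl, rfl⟩ := h
        -- Under an empty ladder the dot commutes with `m` and joins the dots of the first strand;
        -- otherwise it is at the upper right of the last crossing of the ladder.
        obtain rfl | ⟨q₁, l, rfl⟩ := List.eq_nil_or_concat q₁
        · right
          have hc : Commute (dotAt n i) m := hm.commute (by simp [Gen2.width])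
          have e₁ : dotAt n i ^ e * m * ladder n i [] * dotAt n i =
              dotAt n i ^ (e + 1) * m * ladder n i [] := by
            simp only [ladder, mul_one]
            rw [mul_assoc, ← hc.eq, ← mul_assoc, pow_succ]
          simpa [e₁] using IsStandard.cons n i (e + 1) [] q₂ hm
        · left
          rw [mul_assoc, List.concat_eq_append]
          exact (reducible_ladder_dot_last n i l q₁).mul_left _
      · exact right c h₁ (by simpa using h₂)
    | cross j l =>
      -- If the first strand enters the crossing on the right, it undoes the last crossing of the
      -- ladder; if it is further right, a braid appears; if it enters on the left, the ladder grows
      -- by one crossing.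
      obtain ⟨c, hc, rfl, h⟩ | ⟨rfl, h⟩ | ⟨c, h₁, h₂⟩ := append_cons_eq_append hq
      · obtain _ | ⟨j', _ | ⟨l', c⟩⟩ := c
        · exact absurd rfl hc
        · simp only [List.cons_append, List.nil_append, List.cons.injEq] at h
          obtain ⟨rfl, rfl, -⟩ := h
          left
          rw [mul_assoc]
          exact (reducible_ladder_cross_last n i j' a).mul_left _
        · simp only [List.cons_append, List.nil_append, List.cons.injEq] at h
          obtain ⟨rfl, rfl, -⟩ := h
          left
          rw [mul_assoc]
          exact (reducible_ladder_cross n i j' l' a c).mul_left _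
      · simp only [List.cons_append, List.nil_append, List.cons.injEq] at h
        obtain ⟨rfl, rfl⟩ := h
        right
        have key := IsStandard.cons n i e (q₁ ++ [l]) b (m := m) (by simpa using hm)
        rw [ladder_append] at key
        simpa [ladder, mul_assoc] using key
      · exact right c h₁ (by simpa using h₂)

/-- A diagram is reducible or standard. -/
theorem reducible_or_isStandard {p q : List (base I).Gen1} (f : (base I).Mono p q) :
    Reducible (diag 0 f) ∨ IsStandard 0 p q (diag 0 f) := by
  obtain ⟨f, rfl⟩ := f.exists_rep
  -- The letters are added from the bottom to the top, so the standard diagram below them is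
  -- generalized.
  suffices h : ∀ (r : List (base I).Gen1) (m : Diag I), IsStandard 0 r p m →
      Reducible (m * ofList (toList 0 f)) ∨ IsStandard 0 r q (m * ofList (toList 0 f)) by
    have h₁ := h p 1 (.id 0 p)
    rwa [one_mul] at h₁
  induction f with
  | nil p => exact fun r m hm => .inr (by simpa [toList] using hm)
  | cons l f ih =>
    intro r m hm
    simp only [toList, ofList_cons, ← mul_assoc]
    obtain h | h := hm.mul_letter l.left l.right l.gen l.src_eq
    · exact .inl (h.mul_right _)
    · rw [← l.tgt_eq] at h
      exact ih _ _ h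

/-! ### Parametrization of the standard diagrams -/

/-- The standard diagram with positions `c` and dots `a`. -/
def standard : ℕ → List I → List I → List ℕ → List ℕ → Diag I
  | n, i :: p, q, k :: c, a :: e =>
    dotAt n i ^ a * standard (n + 1) p (q.eraseIdx k) c e * ladder n i (q.take k)
  -- The true value for empty lists, and a junk value when the lengths do not match.
  | _, _, _, _, _ => 1

/-- The positions of the strands of a standard diagram from `p` to `q`. -/
def IsCode : List I → List I → List ℕ → Prop
  | [], _, [] => True
  | _ :: p, q, k :: c => k < q.length ∧ IsCode p (q.eraseIdx k) c
  | _, _, _ => False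

/-- The code records the lengths of the successive ladders. -/
theorem IsStandard.exists_code {n : ℕ} {p q : List I} {m : Diag I} (h : IsStandard n p q m) :
    ∃ c e, IsCode p q c ∧ e.length = p.length ∧ m = standard n p q c e := by
  induction h with
  | nil n => exact ⟨[], [], trivial, rfl, rfl⟩
  | cons n i a q₁ q₂ _ ih =>
    obtain ⟨c, e, hc, he, rfl⟩ := ih
    have h : (q₁ ++ i :: q₂).eraseIdx q₁.length = q₁ ++ q₂ := by
      rw [List.eraseIdx_append_of_length_le le_rfl]
      simp
    refine ⟨q₁.length :: c, a :: e, ⟨by simp, by rwa [h]⟩, by simp [he], ?_⟩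
    simp only [standard, h, List.take_left']

end KLR

namespace KLR

open TwoPolygraph

variable {I : Type u}

/-! ### Termination -/

/-- The additive extension of a weight of the crossings, depending on their position, to
diagrams. -/
def weight (f : ℕ → ℕ) : Diag I →* Multiplicative ℕ :=
  PresentedMonoid.lift (rels := Far) (fun x => match x.2 with
    | .cross _ _ => Multiplicative.ofAdd (f x.1)
    | .dot _ => 1) (by
    rintro _ _ ⟨k, l, g, h, -⟩
    simp only [map_mul]
    exact mul_comm _ _)

@[simp] theorem weight_cross (f : ℕ → ℕ) (k : ℕ) (i j : I) :
    weight f (crossAt k i j) = Multiplicative.ofAdd (f k) := rfl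

@[simp] theorem weight_dot (f : ℕ → ℕ) (k : ℕ) (i : I) : weight f (dotAt k i) = 1 := rfl

/-- The action of a generator on pairs consisting of the heights of the strands and the sum of the
heights of the dots met so far: a crossing increases the heights of its strands. -/
def heightStep (k : ℕ) : Gen2 I → (ℕ → ℕ) × ℕ → (ℕ → ℕ) × ℕ
  | .cross _ _, x =>
    (fun m => if m = k then x.1 (k + 1) + 1 else if m = k + 1 then x.1 k + 1 else x.1 m, x.2)
  | .dot _, x => (x.1, x.2 + x.1 k)

theorem heightStep_comm {k l : ℕ} {g h : Gen2 I} (hkl : k + g.width ≤ l)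
    (x : (ℕ → ℕ) × ℕ) :
    heightStep l h (heightStep k g x) = heightStep k g (heightStep l h x) := by
  cases g <;> cases h <;> simp only [Gen2.width] at hkl <;>
    simp only [heightStep, Prod.mk.injEq, true_and, and_true]
  · funext m
    split_ifs <;> omega
  · split_ifs <;> omega
  · split_ifs <;> omega
  · omega

/-- The action of diagrams on heights. -/
def heightHom : Diag I →* (Function.End ((ℕ → ℕ) × ℕ))ᵐᵒᵖ :=
  PresentedMonoid.lift (rels := Far) (M := (Function.End ((ℕ → ℕ) × ℕ))ᵐᵒᵖ)
    (fun x : ℕ × Gen2 I => MulOpposite.op (heightStep x.1 x.2)) (by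
    rintro _ _ ⟨k, l, g, h, hkl⟩
    simp only [map_mul, FreeMonoid.lift_eval_of]
    refine congrArg MulOpposite.op ?_
    funext x
    exact heightStep_comm hkl x)

/-- The heights of the strands and the sum of the heights of the dots, after a diagram. -/
def heights (y : Diag I) : (ℕ → ℕ) × ℕ → (ℕ → ℕ) × ℕ := (heightHom y).unop

theorem heights_mul (y z : Diag I) (x : (ℕ → ℕ) × ℕ) :
    heights (y * z) x = heights z (heights y x) := by
  simp only [heights, map_mul, MulOpposite.unop_mul]
  rfl

@[simp] theorem heights_letter (k : ℕ) (g : Gen2 I) : heights (letter k g) = heightStep k g := rfl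

/-- The heights of the strands do not depend on the dots, so `y` adds the same amount to both sums.
-/
theorem heights_lt (y : Diag I) {x x' : (ℕ → ℕ) × ℕ} (h : x.1 = x'.1) (h' : x.2 < x'.2) :
    (heights y x).2 < (heights y x').2 := by
  obtain ⟨y, rfl⟩ := exists_ofList y
  induction y generalizing x x' with
  | nil => 
    have h₁ : heights (ofList ([] : List (ℕ × Gen2 I))) = _root_.id := rfl
    rw [h₁]
    exact h'
  | cons a y ih =>
    rw [ofList_cons, heights_mul, heights_mul, heights_letter]
    refine ih ?_ ?_ <;> cases a.2 <;> simp only [heightStep, h] <;> omega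

/-- The rank of a diagram on at most `N` strands. -/
def rank (N : ℕ) (y : Diag I) : ℕ ×ₗ ℕ ×ₗ ℕ :=
  toLex ((weight (fun _ => 1) y).toAdd, toLex ((weight (fun k => N - k) y).toAdd,
    (heights y (0, 0)).2))

/-- The diagram `t` has a lower rank than `s` in all contexts. -/
def Lower (N : ℕ) (t s : Diag I) : Prop :=
  (weight (fun _ => 1) t).toAdd < (weight (fun _ => 1) s).toAdd ∨
    (weight (fun _ => 1) t).toAdd = (weight (fun _ => 1) s).toAdd ∧
      ((weight (fun k => N - k) t).toAdd < (weight (fun k => N - k) s).toAdd ∨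
        (weight (fun k => N - k) t).toAdd = (weight (fun k => N - k) s).toAdd ∧
          -- The quantifier over `x` accounts for what lies below in the context; equal strand
          -- heights are needed for what lies above.
          ∀ x, (heights t x).1 = (heights s x).1 ∧ (heights t x).2 < (heights s x).2)

theorem Lower.rank_lt {N : ℕ} {t s : Diag I} (h : Lower N t s) (u v : Diag I) :
    rank N (u * t * v) < rank N (u * s * v) := by
  simp only [rank, Prod.Lex.toLex_lt_toLex, map_mul, toAdd_mul, heights_mul]
  obtain h | ⟨h, h' | ⟨h', h''⟩⟩ := h
  · exact .inl (by omega)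
  · exact .inr ⟨by omega, .inl (by omega)⟩
  · exact .inr ⟨by omega, .inr ⟨by omega, heights_lt v (h'' _).1 (h'' _).2⟩⟩

theorem length_eq_of_mono {p q : List (base I).Gen1} (m : (base I).Mono p q) :
    p.length = q.length := by
  obtain ⟨f, rfl⟩ := m.exists_rep
  induction f with
  | nil p => rfl
  | cons l f ih =>
    rw [← ih, congrArg List.length l.src_eq, congrArg List.length l.tgt_eq]
    simp only [List.length_append]
    rw [length_src, length_tgt]

theorem eq_of_mem_support_add {K : Type x} [Field K] {S : TwoPolygraph.{u, v}}
    {p q : List S.Gen1} {f g : S.LCell K p q} {m : S.Mono p q} (h : m ∈ (f + g).support) :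
    m ∈ f.support ∨ m ∈ g.support := by
  classical
  exact Finset.mem_union.1 (Finsupp.support_add h)

theorem eq_of_mem_support_of {K : Type x} [Field K] {S : TwoPolygraph.{u, v}}
    {p q : List S.Gen1} {m m' : S.Mono p q} (h : m ∈ (LCell.of K m').support) : m = m' :=
  Finset.mem_singleton.1 (Finsupp.support_single_subset h)

/-- The generating 3-cells, given by their source and target. -/
inductive Rule (K : Type x) [Field K] (Γ : SimpleGraph I) : ∀ {r t : List (base I).Gen1},
    (base I).Mono r t → (base I).LCell K r t → Prop
  | dotLeft (i j : I) : i ≠ j → Rule K Γ (crossUL i j) (LCell.of K (crossDR i j))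
  | dotRight (i j : I) : i ≠ j → Rule K Γ (crossUR i j) (LCell.of K (crossDL i j))
  | dotLeftSelf (i : I) :
      Rule K Γ (crossUL i i) (LCell.of K (crossDR i i) + LCell.of K (idm [i, i]))
  | dotRightSelf (i : I) :
      Rule K Γ (crossUR i i) (LCell.of K (crossDL i i) - LCell.of K (idm [i, i]))
  | doubleSelf (i : I) : Rule K Γ (doubleCross i i) 0
  | doubleOrthogonal (i j : I) : pairing Γ i j = 0 →
      Rule K Γ (doubleCross i j) (LCell.of K (idm [i, j]))
  | doubleAdjacent (i j : I) : pairing Γ i j = -1 →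
      Rule K Γ (doubleCross i j) (LCell.of K (dotLeft i j) + LCell.of K (dotRight i j))
  | braid (i j k : I) : ¬ (i = k ∧ pairing Γ i j = -1) →
      Rule K Γ (braidLeft i j k) (LCell.of K (braidRight i j k))
  | braidAdjacent (i j : I) : pairing Γ i j = -1 →
      Rule K Γ (braidLeft i j i) (LCell.of K (braidRight i j i) + LCell.of K (idm [i, j, i]))

theorem exists_rule_of_step {K : Type x} [Field K] {Γ : SimpleGraph I} {p q : List (base I).Gen1}
    {f g : (base I).LCell K p q} (h : (polygraph K Γ).RewritingStep f g) :
    ∃ (r t : List (base I).Gen1) (s : (base I).Mono r t) (T : (base I).LCell K r t)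
      (C : (base I).MonoContext r t p q) (c : K) (h : (base I).LCell K p q),
      Rule K Γ s T ∧ c ≠ 0 ∧ C.fill s ∉ h.support ∧ f = c • LCell.of K (C.fill s) + h ∧
        g = c • C.fillLinear T + h := by
  obtain ⟨α, C, c, h, hc, hC, hf, hg⟩ := h
  refine ⟨_, _, _, _, C, c, h, ?_, hc, hC, hf, hg⟩
  cases α with
  | alphaL i j h => exact .dotLeft i j h
  | alphaR i j h => exact .dotRight i j h
  | alphaLSelf i => exact .dotLeftSelf i
  | alphaRSelf i => exact .dotRightSelf i
  | betaSelf i => exact .doubleSelf i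
  | betaOrthogonal i j h => exact .doubleOrthogonal i j h
  | betaAdjacent i j h => exact .doubleAdjacent i j h
  | gamma i j k h => exact .braid i j k h
  | gammaAdjacent i j h => exact .braidAdjacent i j h

/-- A dot that slides down loses one unit of height. The two sides of a braid have crossings at `n,
n + 1, n` and at `n + 1, n, n + 1`; the bound `n < N` keeps the truncated subtraction `N - n`
strictly above `N - (n + 1)`. The remaining terms lose crossings. -/
theorem Rule.lower {K : Type x} [Field K] {Γ : SimpleGraph I} {r t : List (base I).Gen1}
    {s : (base I).Mono r t} {T : (base I).LCell K r t} (hs : Rule K Γ s T)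
    {m : (base I).Mono r t} (hm : m ∈ T.support) {n N : ℕ} (h : n < N) :
    Lower N (diag n m) (diag n s) := by
  have left (i j : I) : Lower N (diag n (crossDR i j)) (diag n (crossUL i j)) := by
    refine .inr ⟨?_, .inr ⟨?_, fun x => ?_⟩⟩ <;>
      simp [crossDR, crossUL, KLR.dotLeft, KLR.dotRight, heights_mul, heightStep]
  have right (i j : I) : Lower N (diag n (crossDL i j)) (diag n (crossUR i j)) := by
    refine .inr ⟨?_, .inr ⟨?_, fun x => ?_⟩⟩ <;>
      simp [crossDL, crossUR, KLR.dotLeft, KLR.dotRight, heights_mul, heightStep]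
  have braid (i j k : I) : Lower N (diag n (braidRight i j k)) (diag n (braidLeft i j k)) := by
    refine .inr ⟨?_, .inl ?_⟩ <;> simp [braidRight, braidLeft]
    omega
  cases hs with
  | dotLeft i j _ => rw [eq_of_mem_support_of hm]; exact left i j
  | dotRight i j _ => rw [eq_of_mem_support_of hm]; exact right i j
  | dotLeftSelf i =>
    obtain hm | hm := eq_of_mem_support_add hm
    · rw [eq_of_mem_support_of hm]; exact left i i
    · rw [eq_of_mem_support_of hm]
      exact .inl (by simp [crossUL, KLR.dotLeft])
  | dotRightSelf i =>
    rw [sub_eq_add_neg] at hm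
    obtain hm | hm := eq_of_mem_support_add hm
    · rw [eq_of_mem_support_of hm]; exact right i i
    · rw [Finsupp.support_neg] at hm
      rw [eq_of_mem_support_of hm]
      exact .inl (by simp [crossUR, KLR.dotRight])
  | doubleSelf i => exact absurd hm (Finset.notMem_empty _)
  | doubleOrthogonal i j _ =>
    rw [eq_of_mem_support_of hm]
    exact .inl (by simp [doubleCross])
  | doubleAdjacent i j _ =>
    obtain hm | hm := eq_of_mem_support_add hm <;> rw [eq_of_mem_support_of hm] <;>
      exact .inl (by simp [doubleCross, KLR.dotLeft, KLR.dotRight])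
  | braid i j k _ => rw [eq_of_mem_support_of hm]; exact braid i j k
  | braidAdjacent i j _ =>
    obtain hm | hm := eq_of_mem_support_add hm
    · rw [eq_of_mem_support_of hm]; exact braid i j i
    · rw [eq_of_mem_support_of hm]
      exact .inl (by simp [braidLeft])

theorem Rule.source_pos {K : Type x} [Field K] {Γ : SimpleGraph I} {r t : List (base I).Gen1}
    {s : (base I).Mono r t} {T : (base I).LCell K r t} (hs : Rule K Γ s T) : 0 < r.length := by
  cases hs <;> simp

theorem Rule.rank_lt {K : Type x} [Field K] {Γ : SimpleGraph I} {r t p q : List (base I).Gen1}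
    {s : (base I).Mono r t} {T : (base I).LCell K r t} (hs : Rule K Γ s T)
    (C : (base I).MonoContext r t p q) {m : (base I).Mono p q}
    (hm : m ∈ (C.fillLinear T).support) :
    rank p.length (diag 0 m) < rank p.length (diag 0 (C.fill s)) := by
  classical
  obtain ⟨m', hm', rfl⟩ := Finset.mem_image.1 (Finsupp.mapDomain_support hm)
  -- The hole has at least one strand, so its position is below the number of strands, as
  -- `Rule.lower` requires.
  have hl : C.a'.length < p.length := by
    have h₁ := length_eq_of_mono C.m₁
    have h₂ := length_eq_of_mono C.m₂
    have h₃ := hs.source_pos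
    rw [List.length_append, List.length_append] at h₁
    omega
  rw [diag_fill, diag_fill]
  exact (hs.lower hm' (by omega)).rank_lt _ _

/-! ### The multiset order on 2-cells -/

/-- New monomials may cancel with those of `H` or coincide with them, so the part kept is only `G ∩
H`. The removed part contains `m`, which dominates all that is new. -/
theorem isDershowitzMannaLT_map {A L : Type*} [Preorder L] (r : A → L) {F G H : Finset A} {m : A}
    (hm : m ∉ H) (hF : ∀ a, a ∈ F ↔ a = m ∨ a ∈ H) (hG : ∀ a ∈ G, a ∈ H ∨ r a < r m) :
    (G.val.map r).IsDershowitzMannaLT (F.val.map r) := by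
  classical
  have split (B C : Finset A) (hBC : B ⊆ C) :
      C.val.map r = B.val.map r + (C \ B).val.map r := by
    rw [← Multiset.map_add, Finset.sdiff_val, add_tsub_cancel_of_le (Finset.val_le_iff.2 hBC)]
  have hmF : m ∈ F \ (G ∩ H) := by simp [hF, hm]
  refine ⟨(G ∩ H).val.map r, (G \ (G ∩ H)).val.map r, (F \ (G ∩ H)).val.map r, ?_,
    split _ _ Finset.inter_subset_left, split _ _ fun a ha => ?_, fun y hy => ?_⟩
  · rw [Multiset.empty_eq_zero, ne_eq, Multiset.map_eq_zero, Finset.val_eq_zero]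
    exact Finset.ne_empty_of_mem hmF
  · exact (hF a).2 (.inr (Finset.mem_inter.1 ha).2)
  · obtain ⟨a, ha, rfl⟩ := Multiset.mem_map.1 hy
    rw [Finset.mem_val, Finset.mem_sdiff, Finset.mem_inter] at ha
    refine ⟨r m, Multiset.mem_map_of_mem r hmF, (hG a ha.1).resolve_left fun h => ha.2 ⟨ha.1, h⟩⟩

/-- The multiset of the ranks of the monomials of a 2-cell. -/
def ranks {K : Type x} [Field K] {p q : List (base I).Gen1} (f : (base I).LCell K p q) :
    Multiset (ℕ ×ₗ ℕ ×ₗ ℕ) :=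
  f.support.val.map fun m => rank p.length (diag 0 m)

theorem mem_support_smul_of_add {K : Type x} [Field K] {S : TwoPolygraph.{u, v}}
    {p q : List S.Gen1} {c : K} (hc : c ≠ 0) {m : S.Mono p q} {h : S.LCell K p q}
    (hm : m ∉ h.support) (a : S.Mono p q) :
    a ∈ (c • LCell.of K m + h).support ↔ a = m ∨ a ∈ h.support := by
  classical
  rw [Finsupp.notMem_support_iff] at hm
  rw [Finsupp.mem_support_iff, Finsupp.mem_support_iff, LCell.of, Finsupp.smul_single_one,
    Finsupp.add_apply, Finsupp.single_apply]
  by_cases h' : m = a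
  · subst h'
    simp [hm, hc]
  · simp [h', Ne.symm h']

theorem ranks_lt_of_step {K : Type x} [Field K] {Γ : SimpleGraph I} {p q : List (base I).Gen1}
    {f g : (base I).LCell K p q} (h : (polygraph K Γ).RewritingStep f g) :
    (ranks g).IsDershowitzMannaLT (ranks f) := by
  obtain ⟨r, t, s, T, C, c, h, hs, hc, hC, rfl, rfl⟩ := exists_rule_of_step h
  refine isDershowitzMannaLT_map _ hC (mem_support_smul_of_add hc hC) fun a ha => ?_
  obtain ha | ha := eq_of_mem_support_add ha
  · exact .inr (hs.rank_lt C (Finsupp.support_smul ha))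
  · exact .inl ha

theorem wellFounded_step (K : Type x) [Field K] (Γ : SimpleGraph I) (p q : List (base I).Gen1) :
    WellFounded fun f g : (base I).LCell K p q => (polygraph K Γ).RewritingStep g f :=
  Subrelation.wf (fun h => ranks_lt_of_step h)
    (InvImage.wf ranks Multiset.wellFounded_isDershowitzMannaLT)

theorem terminating (K : Type x) [Field K] (Γ : SimpleGraph I) :
    (polygraph K Γ).Terminating := fun p q ⟨f, hf⟩ =>
  (wellFounded_iff_isEmpty_descending_chain.1 (wellFounded_step K Γ p q)).elim ⟨f, hf⟩

end KLR

namespace KLR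

open TwoPolygraph

variable {I : Type u} (K : Type x) [Field K]

/-! ### The polynomial representation -/

/-- The field of rational functions in countably many variables. -/
abbrev RatField : Type x := FractionRing (MvPolynomial ℕ K)

/-- The variables. -/
noncomputable def var (k : ℕ) : RatField K := algebraMap (MvPolynomial ℕ K) _ (MvPolynomial.X k)

theorem var_injective : Function.Injective (var K) :=
  (IsFractionRing.injective (MvPolynomial ℕ K) _).comp MvPolynomial.X_injective

/-- The permutations of the variables. -/
noncomputable def permVar : Equiv.Perm ℕ →* (RatField K ≃ₐ[K] RatField K) :=
  (IsFractionRing.fieldEquivOfAlgEquivHom K (RatField K)).comp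
    { toFun := fun σ => MvPolynomial.renameEquiv K σ
      map_one' := by ext; simp
      map_mul' := fun σ τ => by
        apply AlgEquiv.ext
        intro p
        exact (MvPolynomial.rename_rename τ σ p).symm }

theorem permVar_var (σ : Equiv.Perm ℕ) (k : ℕ) : permVar K σ (var K k) = var K (σ k) := by
  simp [permVar, var]

/-- The transposition of the variables `k` and `k + 1`. -/
noncomputable def trans (k : ℕ) : RatField K ≃ₐ[K] RatField K :=
  permVar K (Equiv.swap k (k + 1))

theorem trans_var (k l : ℕ) : trans K k (var K l) = var K (Equiv.swap k (k + 1) l) :=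
  permVar_var K _ _

@[simp] theorem trans_var_left (k : ℕ) : trans K k (var K k) = var K (k + 1) := by
  rw [trans_var, Equiv.swap_apply_left]

@[simp] theorem trans_var_right (k : ℕ) : trans K k (var K (k + 1)) = var K k := by
  rw [trans_var, Equiv.swap_apply_right]

theorem trans_var_of_ne {k l : ℕ} (h : l ≠ k) (h' : l ≠ k + 1) :
    trans K k (var K l) = var K l := by
  rw [trans_var, Equiv.swap_apply_of_ne_of_ne h h']

@[simp] theorem trans_trans (k : ℕ) (f : RatField K) : trans K k (trans K k f) = f := by
  rw [trans, ← AlgEquiv.mul_apply, ← map_mul, Equiv.swap_mul_self, map_one, AlgEquiv.one_apply]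

theorem trans_comm {k l : ℕ} (h : k + 2 ≤ l) (f : RatField K) :
    trans K l (trans K k f) = trans K k (trans K l f) := by
  rw [trans, trans, ← AlgEquiv.mul_apply, ← AlgEquiv.mul_apply, ← map_mul, ← map_mul,
    (Equiv.Perm.Disjoint.commute ?_).eq]
  intro m
  by_cases hm : m = k ∨ m = k + 1
  · left
    rw [Equiv.swap_apply_of_ne_of_ne] <;> omega
  · right
    rw [Equiv.swap_apply_of_ne_of_ne] <;> omega

theorem trans_braid (k : ℕ) (f : RatField K) :
    trans K k (trans K (k + 1) (trans K k f)) =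
      trans K (k + 1) (trans K k (trans K (k + 1) f)) := by
  simp only [trans, ← AlgEquiv.mul_apply, ← map_mul]
  refine congrArg (fun σ => permVar K σ f) (Equiv.ext fun m => ?_)
  simp only [Equiv.Perm.coe_mul, Function.comp_apply, Equiv.swap_apply_def]
  split_ifs <;> omega

variable {K}

open Classical in
/-- The coefficient of the identity in the operator of a crossing. -/
noncomputable def coeffId (i j : I) (a b : RatField K) : RatField K :=
  if i = j then (a - b)⁻¹ else 0

/-- The orientation of the edges by a well-ordering of the vertices. -/
def Oriented (Γ : SimpleGraph I) (i j : I) : Prop := Γ.Adj i j ∧ WellOrderingRel i j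

open Classical in
/-- The coefficient of the transposition in the operator of a crossing. -/
noncomputable def coeffTrans (Γ : SimpleGraph I) (i j : I) (a b : RatField K) : RatField K :=
  -- With `coeffId`, equal labels give the divided difference (f - s f) / (a - b). For adjacent
  -- labels the factor `a + b` is carried by one of the two crossings only, so that a double
  -- crossing produces it once.
  if i = j then -(a - b)⁻¹ else if Oriented Γ i j then a + b else 1

theorem map_coeffId (s : RatField K ≃ₐ[K] RatField K) (i j : I) (a b : RatField K) :
    s (coeffId i j a b) = coeffId i j (s a) (s b) := by
  unfold coeffId
  split_ifs <;> simp

theorem map_coeffTrans (s : RatField K ≃ₐ[K] RatField K) (Γ : SimpleGraph I) (i j : I)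
    (a b : RatField K) : s (coeffTrans Γ i j a b) = coeffTrans Γ i j (s a) (s b) := by
  unfold coeffTrans
  split_ifs <;> simp

variable (K) in
/-- The operator of a generator: dots act by multiplication, and crossings by divided differences
or by transpositions, up to a factor. -/
noncomputable def genOp (Γ : SimpleGraph I) (k : ℕ) : Gen2 I → Module.End K (RatField K)
  | .cross i j => LinearMap.mulLeft K (coeffId i j (var K k) (var K (k + 1))) +
      LinearMap.mulLeft K (coeffTrans Γ i j (var K k) (var K (k + 1))) ∘ₗ
        (trans K k).toLinearMap
  | .dot _ => LinearMap.mulLeft K (var K k)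

theorem genOp_cross (Γ : SimpleGraph I) (k : ℕ) (i j : I) (f : RatField K) :
    genOp K Γ k (.cross i j) f = coeffId i j (var K k) (var K (k + 1)) * f +
      coeffTrans Γ i j (var K k) (var K (k + 1)) * trans K k f := rfl

theorem genOp_dot (Γ : SimpleGraph I) (k : ℕ) (i : I) (f : RatField K) :
    genOp K Γ k (.dot i) f = var K k * f := rfl

theorem genOp_comm (Γ : SimpleGraph I) {k l : ℕ} {g h : Gen2 I} (hkl : k + g.width ≤ l)
    (f : RatField K) :
    genOp K Γ l h (genOp K Γ k g f) = genOp K Γ k g (genOp K Γ l h f) := by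
  cases g <;> cases h <;> simp only [Gen2.width] at hkl <;>
    simp only [genOp_cross, genOp_dot, map_add, map_mul, map_coeffId, map_coeffTrans]
  · rw [trans_comm K hkl, trans_var_of_ne K (k := k) (l := l) (by omega) (by omega),
      trans_var_of_ne K (k := k) (l := l + 1) (by omega) (by omega),
      trans_var_of_ne K (k := l) (l := k) (by omega) (by omega),
      trans_var_of_ne K (k := l) (l := k + 1) (by omega) (by omega)]
    ring
  · rw [trans_var_of_ne K (k := k) (l := l) (by omega) (by omega)]
    ring
  · rw [trans_var_of_ne K (k := l) (l := k) (by omega) (by omega)]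
    ring
  · ring

/-- The representation of diagrams. -/
noncomputable def repHom (K : Type x) [Field K] (Γ : SimpleGraph I) :
    Diag I →* (Module.End K (RatField K))ᵐᵒᵖ :=
  PresentedMonoid.lift (rels := Far) (M := (Module.End K (RatField K))ᵐᵒᵖ)
    (fun x : ℕ × Gen2 I => MulOpposite.op (genOp K Γ x.1 x.2)) (by
    rintro _ _ ⟨k, l, g, h, hkl⟩
    simp only [map_mul, FreeMonoid.lift_eval_of]
    refine congrArg MulOpposite.op (LinearMap.ext fun f => ?_)
    exact genOp_comm Γ hkl f)

/-- The operator of a diagram. -/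
noncomputable def rep (K : Type x) [Field K] (Γ : SimpleGraph I) (y : Diag I) :
    Module.End K (RatField K) := (repHom K Γ y).unop

theorem rep_one (Γ : SimpleGraph I) : rep K Γ (1 : Diag I) = 1 := by simp [rep]

/-- Diagrams are read from the bottom, and the bottom generator acts first; hence the reversal. -/
theorem rep_mul (Γ : SimpleGraph I) (y z : Diag I) : rep K Γ (y * z) = rep K Γ z * rep K Γ y := by
  simp [rep]

theorem rep_letter (Γ : SimpleGraph I) (k : ℕ) (g : Gen2 I) :
    rep K Γ (letter k g) = genOp K Γ k g := rfl

variable (K) in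
/-- The operator of a 2-cell, the first position being `n`. -/
noncomputable def cellOp (Γ : SimpleGraph I) (n : ℕ) {p q : List (base I).Gen1} :
    (base I).LCell K p q →ₗ[K] Module.End K (RatField K) :=
  Finsupp.linearCombination K fun m => rep K Γ (diag n m)

@[simp] theorem cellOp_of (Γ : SimpleGraph I) (n : ℕ) {p q : List (base I).Gen1}
    (m : (base I).Mono p q) : cellOp K Γ n (LCell.of K m) = rep K Γ (diag n m) := by
  simp [cellOp, LCell.of]

theorem var_sub_ne (n : ℕ) {k l : ℕ} (h : k ≠ l) : var K (n + k) - var K (n + l) ≠ 0 :=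
  sub_ne_zero.2 fun e => h (by have := var_injective K e; omega)

theorem adj_of_pairing {Γ : SimpleGraph I} {i j : I} (h : pairing Γ i j = -1) :
    i ≠ j ∧ Γ.Adj i j := by
  unfold pairing at h
  split_ifs at h with h₁ h₂
  exact ⟨h₁, h₂⟩

theorem not_adj_of_pairing {Γ : SimpleGraph I} {i j : I} (h : pairing Γ i j = 0) :
    i ≠ j ∧ ¬ Γ.Adj i j := by
  unfold pairing at h
  split_ifs at h with h₁ h₂ <;> simp_all

/-- The adjacency of `i` and `j` is oriented in exactly one direction. -/
theorem oriented_cases {Γ : SimpleGraph I} {i j : I} (h : i ≠ j) (h' : Γ.Adj i j) :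
    (Oriented Γ i j ∧ ¬ Oriented Γ j i) ∨ (¬ Oriented Γ i j ∧ Oriented Γ j i) := by
  obtain h₁ | h₁ | h₁ := trichotomous_of WellOrderingRel i j
  · exact .inl ⟨⟨h', h₁⟩, fun h₂ => asymm_of WellOrderingRel h₁ h₂.2⟩
  · exact absurd h₁ h
  · exact .inr ⟨fun h₂ => asymm_of WellOrderingRel h₁ h₂.2, h'.symm, h₁⟩

theorem not_oriented {Γ : SimpleGraph I} {i j : I} (h : ¬ Γ.Adj i j) :
    ¬ Oriented Γ i j ∧ ¬ Oriented Γ j i :=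
  ⟨fun h' => h h'.1, fun h' => h h'.1.symm⟩

/-! ### The KLR relations for the operators -/

section Relations

variable (Γ : SimpleGraph I) (n : ℕ) (f : RatField K)

theorem genOp_double_self (i : I) :
    genOp K Γ n (.cross i i) (genOp K Γ n (.cross i i) f) = 0 := by
  have h₁ : var K n - var K (n + 1) ≠ 0 := var_sub_ne (k := 0) (l := 1) n (by omega)
  have h₂ : var K (n + 1) - var K n ≠ 0 := var_sub_ne (k := 1) (l := 0) n (by omega)
  simp only [genOp_cross, map_add, map_mul, map_coeffId, map_coeffTrans, trans_var_left,
    trans_var_right, trans_trans]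
  simp only [coeffId, coeffTrans, if_true]
  generalize trans K n f = g
  generalize var K n = a at *
  generalize var K (n + 1) = b at *
  field_simp
  ring

theorem genOp_double_of_not_adj {i j : I} (h : i ≠ j) (h' : ¬ Γ.Adj i j) :
    genOp K Γ n (.cross j i) (genOp K Γ n (.cross i j) f) = f := by
  simp only [genOp_cross, map_add, map_mul, map_coeffId, map_coeffTrans, trans_var_left,
    trans_var_right, trans_trans]
  simp only [coeffId, coeffTrans, h, h.symm, if_false, not_oriented h']
  ring

/-- Exactly one of the two crossings carries the factor, which is symmetric in the two variables. -/
theorem genOp_double_of_adj {i j : I} (h : i ≠ j) (h' : Γ.Adj i j) :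
    genOp K Γ n (.cross j i) (genOp K Γ n (.cross i j) f) =
      var K n * f + var K (n + 1) * f := by
  simp only [genOp_cross, map_add, map_mul, map_coeffId, map_coeffTrans, trans_var_left,
    trans_var_right, trans_trans]
  simp only [coeffId, coeffTrans, h, h.symm, if_false]
  obtain ⟨h₁, h₂⟩ | ⟨h₁, h₂⟩ := oriented_cases h h' <;>
  · simp only [h₁, h₂, if_true, if_false]
    ring

theorem trans_succ_var (k : ℕ) : trans K (k + 1) (var K k) = var K k :=
  trans_var_of_ne K (by omega) (by omega)

theorem trans_var_add_two (k : ℕ) : trans K k (var K (k + 2)) = var K (k + 2) :=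
  trans_var_of_ne K (by omega) (by omega)

/-- After all transpositions are moved to the right, the images of `f` are treated as independent
unknowns, and their coefficients are compared as rational functions of three variables. -/
theorem genOp_braid (i j k : I) (h : ¬ (i = k ∧ i ≠ j ∧ Γ.Adj i j)) :
    genOp K Γ n (.cross j k) (genOp K Γ (n + 1) (.cross i k) (genOp K Γ n (.cross i j) f)) =
      genOp K Γ (n + 1) (.cross i j)
        (genOp K Γ n (.cross i k) (genOp K Γ (n + 1) (.cross j k) f)) := by
  have h₁ : var K n - var K (n + 1) ≠ 0 := var_sub_ne (k := 0) (l := 1) n (by omega)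
  have h₂ : var K (n + 1) - var K n ≠ 0 := var_sub_ne (k := 1) (l := 0) n (by omega)
  have h₃ : var K (n + 1) - var K (n + 2) ≠ 0 := var_sub_ne (k := 1) (l := 2) n (by omega)
  have h₄ : var K n - var K (n + 2) ≠ 0 := var_sub_ne (k := 0) (l := 2) n (by omega)
  have h₅ : var K (n + 2) - var K (n + 1) ≠ 0 := var_sub_ne (k := 2) (l := 1) n (by omega)
  simp only [genOp_cross, map_add, map_mul, map_coeffId, map_coeffTrans, trans_var_left,
    trans_var_right, trans_trans, trans_succ_var,
    trans_var_add_two, trans_braid, add_assoc, Nat.reduceAdd]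
  generalize trans K (n + 1) (trans K n (trans K (n + 1) f)) = g₁
  generalize trans K (n + 1) (trans K n f) = g₂
  generalize trans K n (trans K (n + 1) f) = g₃
  generalize trans K n f = g₄
  generalize trans K (n + 1) f = g₅
  generalize var K n = a at *
  generalize var K (n + 1) = b at *
  generalize var K (n + 2) = c at *
  by_cases hij : i = j
  · subst hij
    by_cases hik : i = k
    · subst hik
      simp only [coeffId, coeffTrans, if_true]
      field_simp
      ring
    · simp only [coeffId, coeffTrans, if_true, if_false, hik]
      split_ifs <;> field_simp <;> ring
  · by_cases hik : i = k
    · subst hik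
      have h' := not_oriented fun h' => h ⟨rfl, hij, h'⟩
      simp only [coeffId, coeffTrans, if_true, if_false, hij, Ne.symm hij, h']
      field_simp
      ring
    · by_cases hjk : j = k
      · subst hjk
        simp only [coeffId, coeffTrans, if_true, if_false, hij]
        split_ifs <;> field_simp <;> ring
      -- For distinct labels each pair of strands contributes the same factor, in the same
      -- variables, to both sides.
      · simp only [coeffId, coeffTrans, if_false, hij, hik, hjk]
        ring

/-- With a, b, c the three variables, `f` has the coefficient (a + b) / (a - c) on the left and (b +
c) / (a - c) on the right, whose difference is 1, whichever way the edge is oriented. -/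
theorem genOp_braid_of_adj {i j : I} (h : i ≠ j) (h' : Γ.Adj i j) :
    genOp K Γ n (.cross j i) (genOp K Γ (n + 1) (.cross i i) (genOp K Γ n (.cross i j) f)) =
      genOp K Γ (n + 1) (.cross i j)
        (genOp K Γ n (.cross i i) (genOp K Γ (n + 1) (.cross j i) f)) + f := by
  have h₁ : var K n - var K (n + 1) ≠ 0 := var_sub_ne (k := 0) (l := 1) n (by omega)
  have h₃ : var K (n + 1) - var K (n + 2) ≠ 0 := var_sub_ne (k := 1) (l := 2) n (by omega)
  have h₄ : var K n - var K (n + 2) ≠ 0 := var_sub_ne (k := 0) (l := 2) n (by omega)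
  simp only [genOp_cross, map_add, map_mul, map_coeffId, map_coeffTrans, trans_var_left,
    trans_var_right, trans_trans, trans_succ_var,
    trans_var_add_two, trans_braid, add_assoc, Nat.reduceAdd]
  generalize trans K (n + 1) (trans K n (trans K (n + 1) f)) = g₁
  generalize trans K (n + 1) (trans K n f) = g₂
  generalize trans K n (trans K (n + 1) f) = g₃
  generalize trans K n f = g₄
  generalize trans K (n + 1) f = g₅
  generalize var K n = a at *
  generalize var K (n + 1) = b at *
  generalize var K (n + 2) = c at *
  simp only [coeffId, coeffTrans, if_true, if_false, h, h.symm]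
  obtain ⟨h₁, h₂⟩ | ⟨h₁, h₂⟩ := oriented_cases h h' <;>
  · simp only [h₁, h₂, if_true, if_false]
    field_simp
    ring

end Relations

theorem Rule.rep_eq {Γ : SimpleGraph I} {r t : List (base I).Gen1} {s : (base I).Mono r t}
    {T : (base I).LCell K r t} (h : Rule K Γ s T) (n : ℕ) :
    rep K Γ (diag n s) = cellOp K Γ n T := by
  refine LinearMap.ext fun f => ?_
  have h₁ : var K n - var K (n + 1) ≠ 0 := var_sub_ne (k := 0) (l := 1) n (by omega)
  cases h with
  | dotLeft i j h =>
    simp only [crossUL, crossDR, KLR.dotLeft, KLR.dotRight, cellOp_of, diag_vcomp, diag_hcomp,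
      diag_cross, diag_dot, diag_id, List.length_singleton, one_mul, mul_one, rep_mul, rep_letter,
      Module.End.mul_apply, genOp_cross, genOp_dot, coeffId, h, if_false, map_mul, trans_var_right]
    ring
  | dotRight i j h =>
    simp only [crossUR, crossDL, KLR.dotLeft, KLR.dotRight, cellOp_of, diag_vcomp, diag_hcomp,
      diag_cross, diag_dot, diag_id, List.length_singleton, one_mul, mul_one, rep_mul, rep_letter,
      Module.End.mul_apply, genOp_cross, genOp_dot, coeffId, h, if_false, map_mul, trans_var_left]
    ring
  | dotLeftSelf i =>
    simp only [crossUL, crossDR, KLR.dotLeft, KLR.dotRight, map_add, cellOp_of, diag_vcomp,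
      diag_hcomp, diag_cross, diag_dot, diag_id, List.length_singleton, one_mul, mul_one, rep_mul,
      rep_letter, rep_one, LinearMap.add_apply, Module.End.one_apply, Module.End.mul_apply,
      genOp_cross, genOp_dot, coeffId, coeffTrans, if_true, map_mul, trans_var_right]
    field_simp
    ring
  | dotRightSelf i =>
    simp only [crossUR, crossDL, KLR.dotLeft, KLR.dotRight, map_sub, cellOp_of, diag_vcomp,
      diag_hcomp, diag_cross, diag_dot, diag_id, List.length_singleton, one_mul, mul_one, rep_mul,
      rep_letter, rep_one, LinearMap.sub_apply, Module.End.one_apply, Module.End.mul_apply,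
      genOp_cross, genOp_dot, coeffId, coeffTrans, if_true, map_mul, trans_var_left]
    field_simp
    ring
  | doubleSelf i =>
    simpa [doubleCross, rep_mul, rep_letter] using genOp_double_self Γ n f i
  | doubleOrthogonal i j hp =>
    have hp := not_adj_of_pairing hp
    simpa [doubleCross, rep_mul, rep_letter, rep_one] using genOp_double_of_not_adj Γ n f hp.1 hp.2
  | doubleAdjacent i j hp =>
    have hp := adj_of_pairing hp
    simpa [doubleCross, KLR.dotLeft, KLR.dotRight, rep_mul, rep_letter, genOp_dot]
      using genOp_double_of_adj Γ n f hp.1 hp.2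
  | braid i j k hp =>
    have hp : ¬ (i = k ∧ i ≠ j ∧ Γ.Adj i j) := fun h =>
      hp ⟨h.1, by simp [pairing, h.2.1, h.2.2]⟩
    simpa [braidLeft, braidRight, rep_mul, rep_letter] using genOp_braid Γ n f i j k hp
  | braidAdjacent i j hp =>
    have hp := adj_of_pairing hp
    simpa [braidLeft, braidRight, rep_mul, rep_letter, rep_one]
      using genOp_braid_of_adj Γ n f hp.1 hp.2

end KLR

namespace KLR

open TwoPolygraph

variable {I : Type u} {K : Type x} [Field K]

/-! ### Independence of the standard diagrams -/

variable (K) in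
/-- The multiplication by a rational function. -/
noncomputable abbrev mulOp (a : RatField K) : Module.End K (RatField K) := LinearMap.mulLeft K a

/-- The operator `T ↦ T ∘ var n - var j ∘ T`. -/
noncomputable def twist (n j : ℕ) : Module.End K (RatField K) →ₗ[K] Module.End K (RatField K) :=
  LinearMap.mulRight K (mulOp K (var K n)) - LinearMap.mulLeft K (mulOp K (var K j))

theorem twist_apply (n j : ℕ) (T : Module.End K (RatField K)) :
    twist n j T = T * mulOp K (var K n) - mulOp K (var K j) * T := rfl

theorem twist_mul (n j : ℕ) (T R : Module.End K (RatField K))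
    (h : Commute R (mulOp K (var K n))) : twist n j (T * R) = twist n j T * R := by
  rw [twist_apply, twist_apply, sub_mul, mul_assoc, h.eq, mul_assoc, mul_assoc]

theorem mulOp_comm (a b : RatField K) : Commute (mulOp K a) (mulOp K b) :=
  LinearMap.ext fun f => mul_left_comm a b f

theorem twist_mulOp_mul (n j : ℕ) (a : RatField K) (T : Module.End K (RatField K)) :
    twist n j (mulOp K a * T) = mulOp K a * twist n j T := by
  simp only [twist_apply, mul_sub, ← mul_assoc]
  rw [(mulOp_comm (var K j) a).eq]

theorem algEquiv_mul_mulOp (s : RatField K ≃ₐ[K] RatField K) (a : RatField K) :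
    s.toLinearMap * mulOp K a = mulOp K (s a) * s.toLinearMap :=
  LinearMap.ext fun f => map_mul s a f

theorem twist_algEquiv_mul (n j : ℕ) (s : RatField K ≃ₐ[K] RatField K) {l : ℕ}
    (h : s (var K l) = var K j) (T : Module.End K (RatField K)) :
    twist n j (s.toLinearMap * T) = s.toLinearMap * twist n l T := by
  rw [twist_apply, twist_apply, mul_sub, mul_assoc, ← mul_assoc _ (mulOp K (var K l)) T,
    algEquiv_mul_mulOp, h, mul_assoc]

/-- The composition of the operators `twist n j` for `n ≤ j < n + k`. -/
noncomputable def twists (n : ℕ) :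
    ℕ → (Module.End K (RatField K) →ₗ[K] Module.End K (RatField K))
  | 0 => LinearMap.id
  | k + 1 => twist n (n + k) ∘ₗ twists n k

theorem twists_succ (n k : ℕ) (T : Module.End K (RatField K)) :
    twists n (k + 1) T = twist n (n + k) (twists n k T) := rfl

/-- The right factor will consist of the later strands and the dots, which the twists leave
untouched. -/
theorem twists_mul (n k : ℕ) (T R : Module.End K (RatField K))
    (h : Commute R (mulOp K (var K n))) : twists n k (T * R) = twists n k T * R := by
  induction k with
  | zero => rfl
  | succ k ih => rw [twists_succ, ih, twist_mul _ _ _ _ h, ← twists_succ]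

theorem twists_mulOp_mul (n k : ℕ) (a : RatField K) (T : Module.End K (RatField K)) :
    twists n k (mulOp K a * T) = mulOp K a * twists n k T := by
  induction k with
  | zero => rfl
  | succ k ih => rw [twists_succ, ih, twist_mulOp_mul, ← twists_succ]

theorem twists_trans_mul {n k m : ℕ} (h : n + k ≤ m) (T : Module.End K (RatField K)) :
    twists n k ((trans K m).toLinearMap * T) = (trans K m).toLinearMap * twists n k T := by
  induction k with
  | zero => rfl
  | succ k ih =>
    rw [twists_succ, ih (by omega),
      twist_algEquiv_mul _ _ _ (trans_var_of_ne K (by omega) (by omega)), ← twists_succ]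

/-- Operators `a s` with s(x_n) = x_k are eigenvectors: the twist multiplies them by x_k - x_l, and
kills them when l = k. -/
theorem twist_mulOp_mul_algEquiv {n k l : ℕ} (a : RatField K) (s : RatField K ≃ₐ[K] RatField K)
    (h : s (var K n) = var K k) :
    twist n l (mulOp K a * s.toLinearMap) =
      mulOp K (a * (var K k - var K l)) * s.toLinearMap := by
  refine LinearMap.ext fun f => ?_
  simp only [twist_apply, LinearMap.sub_apply, Module.End.mul_apply, LinearMap.mulLeft_apply,
    AlgEquiv.toLinearMap_apply, map_mul, h]
  ring

/-- In any characteristic X_k + X_l has coefficient 1 at X_k, because k ≠ l. -/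
theorem coeffTrans_ne_zero (Γ : SimpleGraph I) (i j : I) {k l : ℕ} (h : k ≠ l) :
    coeffTrans Γ i j (var K k) (var K l) ≠ 0 := by
  unfold coeffTrans
  split_ifs
  · exact neg_ne_zero.2 (inv_ne_zero (sub_ne_zero.2 fun e => h (var_injective K e)))
  · intro e
    rw [var, var, ← map_add] at e
    have e' := (map_eq_zero_iff _ (IsFractionRing.injective (MvPolynomial ℕ K) _)).1 e
    have e'' := congrArg (MvPolynomial.coeff (Finsupp.single k 1)) e'
    simp [MvPolynomial.coeff_X, Finsupp.single_left_inj, h.symm] at e''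
  · exact one_ne_zero

theorem genOp_cross_mul (Γ : SimpleGraph I) (k : ℕ) (i j : I) (T : Module.End K (RatField K)) :
    genOp K Γ k (.cross i j) * T = mulOp K (coeffId i j (var K k) (var K (k + 1))) * T +
      mulOp K (coeffTrans Γ i j (var K k) (var K (k + 1))) * ((trans K k).toLinearMap * T) := rfl

/-- The leading term of a ladder. -/
theorem twists_ladder (Γ : SimpleGraph I) (n : ℕ) (i : I) (q : List I) :
    ∃ (a : RatField K) (s : RatField K ≃ₐ[K] RatField K), a ≠ 0 ∧
      s (var K n) = var K (n + q.length) ∧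
      twists n q.length (rep K Γ (ladder n i q)) = mulOp K a * s.toLinearMap := by
  -- In the expansion of a ladder, a term whose first omitted transposition is the one at `n + j`
  -- sends x_n to x_{n+j}, and is killed by `twist n (n + j)`. Only the product of all
  -- transpositions survives.
  induction q using List.reverseRecOn with
  | nil =>
    refine ⟨1, AlgEquiv.refl, one_ne_zero, rfl, ?_⟩
    rw [ladder, rep_one]
    refine LinearMap.ext fun f => ?_
    simp [twists]
  | append_singleton q j ih =>
    obtain ⟨a, s, ha, hs, h⟩ := ih
    -- The last twist kills the identity part of the new crossing. Moved through its transposition,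
    -- it becomes `twist n (n + q.length + 1)`, which yields the difference of variables.
    refine ⟨coeffTrans Γ i j (var K (n + q.length)) (var K (n + q.length + 1)) *
        trans K (n + q.length) (a * (var K (n + q.length) - var K (n + q.length + 1))),
      s.trans (trans K (n + q.length)), ?_, ?_, ?_⟩
    · refine mul_ne_zero (coeffTrans_ne_zero Γ i j (by omega)) ?_
      rw [ne_eq, map_eq_zero_iff _ (trans K _).injective]
      exact mul_ne_zero ha (var_sub_ne (k := 0) (l := 1) _ (by omega))
    · rw [AlgEquiv.trans_apply, hs, trans_var_left, List.length_append]
      rfl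
    · rw [ladder_append, ladder, ladder, mul_one, rep_mul, rep_letter, List.length_append,
        List.length_singleton, genOp_cross_mul, map_add, twists_mulOp_mul, twists_mulOp_mul,
        twists_succ, twists_succ, twists_trans_mul le_rfl,
        twist_algEquiv_mul _ _ _ (trans_var_right K _), h, twist_mulOp_mul_algEquiv _ _ hs,
        twist_mulOp_mul_algEquiv _ _ hs, ← mul_assoc (trans K _).toLinearMap, algEquiv_mul_mulOp]
      refine LinearMap.ext fun f => ?_
      simp [mul_assoc]

/-- The surviving term sends x_n to x_{n + q.length}, so the next twist kills it as well. -/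
theorem twists_ladder_of_lt (Γ : SimpleGraph I) (n : ℕ) (i : I) (q : List I) {k : ℕ}
    (h : q.length < k) : twists n k (rep K Γ (ladder n i q)) = 0 := by
  induction k, h using Nat.le_induction with
  | base =>
    obtain ⟨a, s, -, hs, h⟩ := twists_ladder (K := K) Γ n i q
    rw [twists_succ, h, twist_mulOp_mul_algEquiv _ _ hs]
    refine LinearMap.ext fun f => ?_
    simp
  | succ k _ ih => rw [twists_succ, ih, map_zero]

variable (K) in
/-- The operator of a standard diagram without dots. -/
noncomputable def codeOp (Γ : SimpleGraph I) :
    ℕ → List I → List I → List ℕ → Module.End K (RatField K)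
  | n, i :: p, q, k :: c =>
    rep K Γ (ladder n i (q.take k)) * codeOp Γ (n + 1) p (q.eraseIdx k) c
  | _, _, _, _ => 1

variable (K) in
/-- The monomial of the dots of a standard diagram. -/
noncomputable def dots : ℕ → List ℕ → RatField K
  | _, [] => 1
  | n, a :: e => var K n ^ a * dots (n + 1) e

theorem commute_codeOp (Γ : SimpleGraph I) {l n : ℕ} (h : l < n) (p q : List I) (c : List ℕ) :
    Commute (codeOp K Γ n p q c) (mulOp K (var K l)) := by
  induction c generalizing n p q with
  | nil => cases p <;> exact Commute.one_left _
  | cons k c ih =>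
    cases p with
    | nil => exact Commute.one_left _
    | cons i p =>
      refine Commute.mul_left ?_ (ih (by omega) _ _)
      -- Multiplication by `var K l` is the operator of a dot at `l` with any label, so the
      -- commutation of diagrams applies.
      have h₁ := commute_letter_ladder (k := l) i (q.take k) (.dot i)
        (by simpa [Gen2.width] using h)
      have h₂ := congrArg (rep K Γ) h₁.eq
      rwa [rep_mul, rep_mul] at h₂

theorem mulOp_mul (a b : RatField K) : mulOp K (a * b) = mulOp K a * mulOp K b :=
  LinearMap.ext fun f => mul_assoc a b f

/-- Dots at the bottom act first, hence become a right factor: they are scalars for the right action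
in which the codes are independent. -/
theorem rep_standard (Γ : SimpleGraph I) {n : ℕ} {p q : List I} {c e : List ℕ}
    (hc : IsCode p q c) (he : e.length = p.length) :
    rep K Γ (standard n p q c e) = codeOp K Γ n p q c * mulOp K (dots K n e) := by
  induction p generalizing n q c e with
  | nil =>
    obtain rfl := List.eq_nil_of_length_eq_zero he
    cases c with
    | nil =>
      refine LinearMap.ext fun f => ?_
      simp [standard, codeOp, dots, rep_one]
    | cons k c => cases q <;> exact hc.elim
  | cons i p ih =>
    obtain _ | ⟨a, e⟩ := e
    · simp at he
    obtain _ | ⟨k, c⟩ := c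
    · exact hc.elim
    have hp : rep K Γ (dotAt n i ^ a) = mulOp K (var K n ^ a) := by
      clear he
      induction a with
      | zero =>
        refine LinearMap.ext fun f => ?_
        simp [rep_one]
      | succ a ih =>
        rw [pow_succ, rep_mul, ih, pow_succ', mulOp_mul]
        rfl
    rw [standard, rep_mul, rep_mul, ih hc.2 (by simpa using he), hp, codeOp, dots,
      mul_comm (var K n ^ a), mulOp_mul]
    simp only [mul_assoc]

theorem twists_codeOp (Γ : SimpleGraph I) {n k l : ℕ} {i : I} (p : List I) {q : List I}
    (c : List ℕ) (b : RatField K) {T : Module.End K (RatField K)}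
    (h : twists n k (rep K Γ (ladder n i (q.take l))) = T) :
    twists n k (codeOp K Γ n (i :: p) q (l :: c) * mulOp K b) =
      T * (codeOp K Γ (n + 1) p (q.eraseIdx l) c * mulOp K b) := by
  have hc : Commute (codeOp K Γ (n + 1) p (q.eraseIdx l) c * mulOp K b) (mulOp K (var K n)) :=
    Commute.mul_left (commute_codeOp Γ (Nat.lt_succ_self n) p _ c) (mulOp_comm b _)
  have e : codeOp K Γ n (i :: p) q (l :: c) =
    rep K Γ (ladder n i (q.take l)) * codeOp K Γ (n + 1) p (q.eraseIdx l) c := rfl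
  rw [e, mul_assoc, twists_mul n k _ _ hc, h]

theorem twists_codeOp_of_lt (Γ : SimpleGraph I) {n k l : ℕ} {i : I} (p : List I) {q : List I}
    (c : List ℕ) (b : RatField K) (h : (q.take l).length < k) :
    twists n k (codeOp K Γ n (i :: p) q (l :: c) * mulOp K b) = 0 := by
  rw [twists_codeOp Γ p c b (twists_ladder_of_lt Γ n i _ h), zero_mul]

/-- The operators of the standard diagrams without dots are independent over the field of rational
functions, acting on the right. -/
theorem eq_zero_of_codeOp_sum (Γ : SimpleGraph I) (n : ℕ) (p q : List I)
    (P : List ℕ →₀ RatField K) (hP : ∀ c ∈ P.support, IsCode p q c)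
    (h : P.sum (fun c a => codeOp K Γ n p q c * mulOp K a) = 0) : P = 0 := by
  induction p generalizing n q P with
  | nil =>
    have hP' : P = Finsupp.single [] (P []) := by
      refine Finsupp.ext fun c => ?_
      obtain _ | ⟨k, c⟩ := c
      · simp
      · rw [Finsupp.single_apply, if_neg (by simp)]
        by_contra hc
        have := hP _ (Finsupp.mem_support_iff.2 hc)
        cases q <;> exact this
    rw [hP', Finsupp.sum_single_index (by simp)] at h
    have h' := LinearMap.congr_fun h 1
    rw [hP']
    simpa [codeOp] using h'
  | cons i p ih =>
    by_contra hne
    -- With `k` the largest first entry in the support, `twists n k` kills the codes with a smaller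
    -- one and leaves a common injective left factor `a s` on the others. The default of `headD`
    -- plays no role, as codes are nonempty here.
    obtain ⟨c₀, hc₀, hmax⟩ := Finset.exists_max_image P.support (fun c => c.headD 0)
      (Finsupp.support_nonempty_iff.2 hne)
    obtain _ | ⟨k, c₀⟩ := c₀
    · exact (hP _ hc₀).elim
    have hk : k < q.length := (hP _ hc₀).1
    have hlen {l : ℕ} (hl : l < q.length) : (q.take l).length = l := by
      rw [List.length_take]; omega
    obtain ⟨a, s, ha, -, hs⟩ := twists_ladder (K := K) Γ n i (q.take k)
    rw [hlen hk] at hs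
    -- The coefficients of the codes that begin with `k`, indexed by their tails.
    set P' : List ℕ →₀ RatField K := P.comapDomain (List.cons k) (by simp) with hP'
    have hsum := congrArg (twists n k) h
    rw [map_zero, Finsupp.sum, map_sum,
      ← Finset.sum_preimage (List.cons k) P.support (by simp)] at hsum
    · refine Finsupp.mem_support_iff.1 hc₀ ?_
      have key : P' = 0 := by
        refine ih (n + 1) (q.eraseIdx k) P' (fun c hc => ?_) ?_
        · refine (hP (k :: c) ?_).2
          simpa [hP'] using hc
        · refine LinearMap.ext fun f => ?_
          have h₁ := LinearMap.congr_fun hsum f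
          rw [Finset.sum_congr rfl (g := fun c => mulOp K a * s.toLinearMap *
            (codeOp K Γ (n + 1) p (q.eraseIdx k) c * mulOp K (P' c))), ← Finset.mul_sum] at h₁
          · simp only [Module.End.mul_apply, LinearMap.mulLeft_apply, LinearMap.zero_apply,
              AlgEquiv.toLinearMap_apply, mul_eq_zero, ha, false_or] at h₁
            exact (map_eq_zero_iff _ s.injective).1 h₁
          · intro c _
            exact twists_codeOp Γ p c _ hs
      have := DFunLike.congr_fun key c₀
      simpa [hP'] using this
    · intro c hc hck
      obtain _ | ⟨l, c⟩ := c
      · exact (hP _ hc).elim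
      have hl : l ≤ k := hmax _ hc
      have hlk : l ≠ k := fun e => hck ⟨c, by rw [e]⟩
      exact twists_codeOp_of_lt Γ p c _ (by rw [hlen (hP _ hc).1]; omega)

/-- The exponents of the dots of a standard diagram. -/
noncomputable def exponents : ℕ → List ℕ → ℕ →₀ ℕ
  | _, [] => 0
  | n, a :: e => Finsupp.single n a + exponents (n + 1) e

theorem exponents_of_lt {n k : ℕ} (h : k < n) (e : List ℕ) : exponents n e k = 0 := by
  induction e generalizing n with
  | nil => rfl
  | cons a e ih =>
    rw [exponents, Finsupp.add_apply, ih (by omega), Finsupp.single_apply, if_neg (by omega)]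

/-- Equal lengths are needed because trailing zeros leave no trace in the exponents. -/
theorem exponents_injective (n : ℕ) {e e' : List ℕ} (hl : e.length = e'.length)
    (h : exponents n e = exponents n e') : e = e' := by
  induction e generalizing n e' with
  | nil => exact (List.eq_nil_of_length_eq_zero hl.symm).symm
  | cons a e ih =>
    obtain _ | ⟨a', e'⟩ := e'
    · simp at hl
    · have h₁ := DFunLike.congr_fun h n
      simp only [exponents, Finsupp.add_apply, Finsupp.single_eq_same,
        exponents_of_lt (Nat.lt_succ_self n), add_zero] at h₁
      subst h₁
      rw [ih (n + 1) (by simpa using hl) (add_left_cancel h)]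

theorem dots_eq (n : ℕ) (e : List ℕ) :
    dots K n e = algebraMap (MvPolynomial ℕ K) _ (MvPolynomial.monomial (exponents n e) 1) := by
  induction e generalizing n with
  | nil => simp [dots, exponents]
  | cons a e ih =>
    rw [dots, ih, exponents, var, ← map_pow, ← map_mul, MvPolynomial.X_pow_eq_monomial,
      MvPolynomial.monomial_mul, one_mul]

/-- A linear combination of irreducible monomials is determined by its operator. -/
theorem eq_zero_of_cellOp (Γ : SimpleGraph I) {p q : List (base I).Gen1}
    (d : (base I).LCell K p q) (hd : ∀ m ∈ d.support, ¬ Reducible (diag 0 m))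
    (h : cellOp K Γ 0 d = 0) : d = 0 := by
  classical
  have hex (m : (base I).Mono p q) : ∃ x : List ℕ × List ℕ, m ∈ d.support →
      IsCode p q x.1 ∧ x.2.length = p.length ∧ diag 0 m = standard 0 p q x.1 x.2 := by
    by_cases hm : m ∈ d.support
    · obtain ⟨c, e, hx⟩ := ((reducible_or_isStandard m).resolve_left (hd m hm)).exists_code
      exact ⟨(c, e), fun _ => hx⟩
    -- Outside the support the choice is immaterial.
    · exact ⟨default, fun h => absurd h hm⟩
  choose x hx using hex
  -- The monomials are grouped by code, their dots being absorbed into the coefficients.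
  set P : List ℕ →₀ RatField K :=
    ∑ m ∈ d.support, Finsupp.single (x m).1 (d m • dots K 0 (x m).2) with hP
  have hP0 : P = 0 := by
    refine eq_zero_of_codeOp_sum Γ 0 p q P (fun c hc => ?_) ?_
    · obtain ⟨m, hm, hc⟩ := Finset.mem_biUnion.1 (Finsupp.support_finsetSum hc)
      rw [Finset.mem_singleton.1 (Finsupp.support_single_subset hc)]
      exact (hx m hm).1
    · rw [hP, ← Finsupp.sum_finsetSum_index (fun c => ?_) (fun c a b => ?_)]
      · rw [← h, cellOp, Finsupp.linearCombination_apply, Finsupp.sum]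
        refine Finset.sum_congr rfl fun m hm => ?_
        obtain ⟨h₁, h₂, h₃⟩ := hx m hm
        rw [Finsupp.sum_single_index, h₃, rep_standard Γ h₁ h₂]
        · refine LinearMap.ext fun f => ?_
          simp
        · refine LinearMap.ext fun f => ?_
          simp
      · refine LinearMap.ext fun f => ?_
        simp
      · refine LinearMap.ext fun f => ?_
        simp [add_mul]
  refine Finsupp.ext fun m₀ => ?_
  by_contra hm₀
  rw [Finsupp.zero_apply, ← ne_eq, ← Finsupp.mem_support_iff] at hm₀
  -- The coefficient of `P` at the code of `m₀`, as a polynomial. Its coefficient at the exponents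
  -- of `m₀` is `d m₀`, because a monomial with the same code and the same exponents is `m₀` itself.
  set F : MvPolynomial ℕ K := ∑ m ∈ d.support,
    if (x m).1 = (x m₀).1 then MvPolynomial.monomial (exponents 0 (x m).2) (d m) else 0 with hF
  have hF0 : F = 0 := by
    have h₁ := DFunLike.congr_fun hP0 (x m₀).1
    rw [hP, Finsupp.finsetSum_apply] at h₁
    refine IsFractionRing.injective (MvPolynomial ℕ K) (RatField K) ?_
    rw [map_zero, hF, map_sum]
    refine Eq.trans (Finset.sum_congr rfl fun m _ => ?_) h₁
    rw [Finsupp.single_apply]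
    split_ifs
    · have h₂ : MvPolynomial.monomial (exponents 0 (x m).2) (d m) =
          d m • MvPolynomial.monomial (exponents 0 (x m).2) (1 : K) := by
        rw [MvPolynomial.smul_monomial, smul_eq_mul, mul_one]
      rw [dots_eq, h₂]
      exact (map_smul (IsScalarTower.toAlgHom K (MvPolynomial ℕ K) (RatField K)) _ _)
    · exact map_zero _
  have h₁ := congrArg (MvPolynomial.coeff (exponents 0 (x m₀).2)) hF0
  rw [hF, MvPolynomial.coeff_sum, Finset.sum_eq_single_of_mem m₀ hm₀, if_pos rfl,
    MvPolynomial.coeff_monomial, if_pos rfl, MvPolynomial.coeff_zero] at h₁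
  · exact Finsupp.mem_support_iff.1 hm₀ h₁
  · intro m hm hne
    split_ifs with h₂
    · rw [MvPolynomial.coeff_monomial, if_neg]
      intro h₃
      refine hne (diag_injective ?_)
      rw [(hx m hm).2.2, (hx m₀ hm₀).2.2, h₂, exponents_injective 0 _ h₃]
      rw [(hx m hm).2.1, (hx m₀ hm₀).2.1]
    · exact MvPolynomial.coeff_zero _

end KLR

/-! ### Isomorphisms of quotients -/

namespace LinearTwoCat

variable {K : Type x} [Field K]

/-- The identity of a linear (2,2)-category. -/
def Iso.refl (C : LinearTwoCat.{u, v, w, x} K) : Iso C C where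
  functor := 𝟭 _
  obj_bijective := Function.bijective_id
  map_bijective _ _ := Function.bijective_id
  map2 _ _ := LinearEquiv.refl K _
  map2_id2 _ := rfl
  map2_vcomp _ _ := rfl
  map2_hcomp _ _ := HEq.rfl

theorem Congruence.ext_rel {C : LinearTwoCat.{u, v, w, x} K} {E E' : C.Congruence}
    (h : ∀ {a b : C.Cell0} {p q : a ⟶ b} (f g : C.Cell2 p q), E.rel f g ↔ E'.rel f g) :
    E = E' := by
  cases E
  cases E'
  congr
  funext a b p q f g
  exact propext (h f g)

end LinearTwoCat

namespace KLR

open TwoPolygraph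

variable {I : Type u} {K : Type x} [Field K]

/-! ### Confluence -/

/-- A context multiplies operators by fixed operators on both sides, so the equality for a rule at
any position passes to all contexts. -/
theorem cellOp_fillLinear (Γ : SimpleGraph I) (n : ℕ) {r t p q : List (base I).Gen1}
    (C : (base I).MonoContext r t p q) (f : (base I).LCell K r t) :
    cellOp K Γ n (C.fillLinear f) =
      rep K Γ (diag (n + C.a'.length + t.length) C.m₃ * diag n C.m₄) *
        (cellOp K Γ (n + C.a'.length) f * rep K Γ (diag n C.m₁ * diag n C.m₂)) := by
  induction f using Finsupp.induction_linear with
  | zero => simp [MonoContext.fillLinear]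
  | add f g hf hg =>
    rw [MonoContext.fillLinear] at hf hg ⊢
    rw [Finsupp.mapDomain_add, map_add, hf, hg, map_add, add_mul, mul_add]
  | single m c =>
    rw [MonoContext.fillLinear, Finsupp.mapDomain_single, cellOp, cellOp,
      Finsupp.linearCombination_single, Finsupp.linearCombination_single, diag_fill, rep_mul,
      rep_mul _ _ (diag (n + C.a'.length) m), smul_mul_assoc, mul_smul_comm]

theorem cellOp_eq_of_step {Γ : SimpleGraph I} {p q : List (base I).Gen1}
    {f g : (base I).LCell K p q} (h : (polygraph K Γ).RewritingStep f g) :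
    cellOp K Γ 0 f = cellOp K Γ 0 g := by
  obtain ⟨r, t, s, T, C, c, h, hs, -, -, rfl, rfl⟩ := exists_rule_of_step h
  rw [map_add, map_add, map_smul, map_smul, cellOp_of, cellOp_fillLinear, diag_fill, rep_mul,
    rep_mul _ _ (diag (0 + C.a'.length) s), hs.rep_eq]

theorem cellOp_eq_of_rewritesTo {Γ : SimpleGraph I} {p q : List (base I).Gen1}
    {f g : (base I).LCell K p q} (h : (polygraph K Γ).RewritesTo f g) :
    cellOp K Γ 0 f = cellOp K Γ 0 g := by
  induction h with
  | refl => rfl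
  | tail _ h ih => exact ih.trans (cellOp_eq_of_step h)

theorem exists_step_of_reducible (Γ : SimpleGraph I) {p q : List (base I).Gen1}
    (f : (base I).LCell K p q) {m : (base I).Mono p q} (hm : m ∈ f.support)
    (h : Reducible (diag 0 m)) : ∃ g, (polygraph K Γ).RewritingStep f g := by
  classical
  obtain ⟨α, C, rfl⟩ := exists_fill_of_reducible K Γ m h
  refine ⟨_, α, C, f (C.fill ((polygraph K Γ).src2 α)), f.erase (C.fill ((polygraph K Γ).src2 α)),
    Finsupp.mem_support_iff.1 hm, ?_, ?_, rfl⟩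
  · exact fun h => (Finsupp.mem_support_iff.1 h) Finsupp.erase_same
  · refine (Finsupp.single_add_erase (C.fill ((polygraph K Γ).src2 α)) f).symm.trans ?_
    exact congrArg (· + _) (Finsupp.smul_single_one _ _).symm

theorem exists_normalForm (Γ : SimpleGraph I) {p q : List (base I).Gen1}
    (f : (base I).LCell K p q) :
    ∃ g : (base I).LCell K p q, (polygraph K Γ).RewritesTo f g ∧
      ∀ m ∈ g.support, ¬ Reducible (diag 0 m) := by
  induction f using (wellFounded_step K Γ p q).induction with
  | _ f ih =>
    by_cases h : ∀ m ∈ f.support, ¬ Reducible (diag 0 m)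
    · exact ⟨f, .refl, h⟩
    · push Not at h
      obtain ⟨m, hm, h⟩ := h
      obtain ⟨g, hg⟩ := exists_step_of_reducible Γ f hm h
      obtain ⟨g', hg', h'⟩ := ih g hg
      exact ⟨g', .head hg hg', h'⟩

/-- The operator is constant along rewriting, so the difference of two normal forms is a combination
of irreducible monomials with zero operator. -/
theorem confluent (K : Type x) [Field K] (Γ : SimpleGraph I) : (polygraph K Γ).Confluent := by
  classical
  intro p q f g h hg hh
  obtain ⟨g', hg', hirr⟩ := exists_normalForm Γ (p := p) (q := q) g
  obtain ⟨h', hh', hirr'⟩ := exists_normalForm Γ (p := p) (q := q) h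
  have e : g' - h' = 0 := by
    refine eq_zero_of_cellOp Γ _ (fun m hm => ?_) ?_
    · rw [sub_eq_add_neg] at hm
      obtain hm | hm := eq_of_mem_support_add hm
      · exact hirr m hm
      · rw [Finsupp.support_neg] at hm
        exact hirr' m hm
    · rw [map_sub, sub_eq_zero, ← cellOp_eq_of_rewritesTo hg', ← cellOp_eq_of_rewritesTo hh']
      exact (cellOp_eq_of_rewritesTo hg).symm.trans (cellOp_eq_of_rewritesTo hh)
  exact ⟨g', hg', by rwa [sub_eq_zero.1 e]⟩

/-! ### Presentation -/

theorem Relation.congruence (Γ : SimpleGraph I) {p q : List I} {f g : (base I).LCell K p q}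
    (h : Relation K Γ f g) : Nonempty ((polygraph K Γ).Cell3 (p := p) (q := q) f g) := by
  cases h with
  | double_self i => exact ⟨.gen (P := polygraph K Γ) (.betaSelf i)⟩
  | double_orthogonal i j h => exact ⟨.gen (P := polygraph K Γ) (.betaOrthogonal i j h)⟩
  | double_adjacent i j h => exact ⟨.gen (P := polygraph K Γ) (.betaAdjacent i j h)⟩
  | dot_left i j h => exact ⟨.gen (P := polygraph K Γ) (.alphaL i j h)⟩
  | dot_right i j h => exact ⟨.gen (P := polygraph K Γ) (.alphaR i j h)⟩
  | dot_left_self i => exact ⟨.gen (P := polygraph K Γ) (.alphaLSelf i)⟩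
  | dot_right_self i => exact ⟨.gen (P := polygraph K Γ) (.alphaRSelf i)⟩
  | braid i j k h => exact ⟨.gen (P := polygraph K Γ) (.gamma i j k h)⟩
  | braid_adjacent i j h =>
    -- The rule has the right braid in its target, the relation in its source: its negative is added
    -- on both sides.
    have A := LinearPolygraph.Cell3.gen (P := polygraph K Γ) (.gammaAdjacent i j h)
    have B := A.add (.id (-LCell.of K (braidRight i j i)))
    have e₁ : LCell.of K (braidLeft i j i) + -LCell.of K (braidRight i j i) =
      LCell.of K (braidLeft i j i) - LCell.of K (braidRight i j i) := (sub_eq_add_neg _ _).symm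
    have e₂ : LCell.of K (braidRight i j i) + LCell.of K (idm [i, j, i]) +
      -LCell.of K (braidRight i j i) = LCell.of K (idm [i, j, i]) := add_neg_cancel_comm _ _
    exact ⟨e₁ ▸ e₂ ▸ B⟩

/-- The congruence generated by the relations. -/
noncomputable abbrev relationCongruence (K : Type x) [Field K] (Γ : SimpleGraph I) :
    ((base I).freeLinear K).Congruence :=
  LinearTwoCat.Congruence.generate (C := (base I).freeLinear K)
    (fun {_ _ p q} f g => Relation K Γ (p := p) (q := q) f g)

theorem relationCongruence_of (Γ : SimpleGraph I) {a b : ((base I).freeLinear K).Cell0}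
    {p q : List I} {f g : (base I).LCell K p q} (h : Relation K Γ f g) :
    (relationCongruence K Γ).rel (a := a) (b := b) (p := p) (q := q) f g :=
  fun _ hE => hE _ _ h

theorem relationCongruence_of_cell3 (Γ : SimpleGraph I) (a b : ((base I).freeLinear K).Cell0)
    {p q : List (polygraph K Γ).base.Gen1} {f g : (polygraph K Γ).base.LCell K p q}
    (A : (polygraph K Γ).Cell3 f g) :
    (relationCongruence K Γ).rel (a := a) (b := b) (p := p) (q := q) f g := by
  induction A with
  | gen α =>
    cases α with
    | alphaL i j h => exact relationCongruence_of Γ (.dot_left i j h)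
    | alphaR i j h => exact relationCongruence_of Γ (.dot_right i j h)
    | alphaLSelf i => exact relationCongruence_of Γ (.dot_left_self i)
    | alphaRSelf i => exact relationCongruence_of Γ (.dot_right_self i)
    | betaSelf i => exact relationCongruence_of Γ (.double_self i)
    | betaOrthogonal i j h => exact relationCongruence_of Γ (.double_orthogonal i j h)
    | betaAdjacent i j h => exact relationCongruence_of Γ (.double_adjacent i j h)
    | gamma i j k h => exact relationCongruence_of Γ (.braid i j k h)
    | gammaAdjacent i j h =>
      have B := (relationCongruence K Γ).add
        ((relationCongruence K Γ).refl (a := a) (b := b) (p := [i, j, i]) (q := [i, j, i])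
          (LCell.of K (braidRight i j i)))
        (relationCongruence_of Γ (a := a) (b := b) (.braid_adjacent (K := K) i j h))
      have e : LCell.of K (braidRight i j i) +
        (LCell.of K (braidLeft i j i) - LCell.of K (braidRight i j i)) =
          LCell.of K (braidLeft i j i) := add_sub_cancel _ _
      exact e ▸ B
  | id f => exact (relationCongruence K Γ).refl _
  | comp2 _ _ ih ih' => exact (relationCongruence K Γ).trans ih ih'
  | comp1 _ _ ih ih' => exact (relationCongruence K Γ).vcomp ih ih'
  -- There is only one 0-cell, so the hypotheses stated from `a` to `b` also serve from `b` to `b`.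
  | comp0 _ _ ih ih' => exact (relationCongruence K Γ).hcomp (a := a) (b := a) (c := b) ih ih'
  | add _ _ ih ih' => exact (relationCongruence K Γ).add ih ih'
  | smul c _ ih => exact (relationCongruence K Γ).smul c ih

theorem congruence_eq (K : Type x) [Field K] (Γ : SimpleGraph I) :
    (polygraph K Γ).congruence = relationCongruence K Γ := by
  refine LinearTwoCat.Congruence.ext_rel fun {a b p q} f g => ⟨?_, fun h => ?_⟩
  · rintro ⟨A⟩
    exact relationCongruence_of_cell3 Γ a b A
  · exact h (polygraph K Γ).congruence fun f g h => h.congruence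

theorem presents (K : Type x) [Field K] (Γ : SimpleGraph I) :
    (polygraph K Γ).Presents (category K Γ) := by
  -- Both sides are quotients of the same free category by equal congruences, so the identity is the
  -- isomorphism.
  have h : category K Γ = (polygraph K Γ).congruence.quotient := by
    rw [congruence_eq]
    rfl
  rw [h]
  exact ⟨.refl _⟩

end KLR

theorem theorem2p3 {K : Type x} [Field K] {I : Type u} (Γ : SimpleGraph I) :
    (KLR.polygraph K Γ).Convergent ∧ (KLR.polygraph K Γ).Presents (KLR.category K Γ) := by
  exact ⟨⟨KLR.terminating K Γ, KLR.confluent K Γ⟩, KLR.presents K Γ⟩
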